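/- Let $G$ be a group that is the directed union of a family of subgroups $(G_\lambda)_{\lambda\in\Lambda}$, i.e. $G=\bigcup_{\lambda} G_\lambda$ and for all $\lambda,\mu\in\Lambda$ there is $\nu\in\Lambda$ with $G_\lambda\le G_\nu$ and $G_\mu\le G_\nu$. Then (i) $\underline{\underline{\mathrm{hd}}}\,G=\sup_{\lambda\in\Lambda}\underline{\underline{\mathrm{hd}}}\,G_\lambda$; (ii) if $\Lambda$ is countable, then $\underline{\underline{\mathrm{cd}}}\,G\le \sup_{\lambda\in\Lambda}\underline{\underline{\mathrm{cd}}}\,G_\lambda+1$. Here all dimensions take values in $\{0,1,2,\dots\}\cup\{\infty\}$ and are defined as follows. For a group $K$ let $\mathfrak F_{vc}(K)$ be the family of all virtually cyclic subgroups of $K$ (those having a cyclic subgroup of finite index, so finite subgroups are included), and let $\mathcal O$ be the orbit category whose objects are the $K$-sets $K/H$ with $H\in\mathfrak F_{vc}(K)$ and whose morphisms are all $K$-maps. A right (left) Bredon module is a contravariant (covariant) functor from $\mathcal O$ to abelian groups, and the trivial right Bredon module $\underline{\mathbb Z}$ is the constant functor with value $\mathbb Z$. For a right module $M$ and a left module $N$,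 the tensor product $M\otimes N$ over $\mathcal O$ is the coend of $(x,y)\mapsto M(x)\otimes_{\mathbb Z}N(y)$; $M$ is flat if the left derived functors $\mathrm{Tor}_i(?,N)$ of $?\otimes N$ vanish on $M$ for all $i\ge 1$ and all left modules $N$. Then $\underline{\underline{\mathrm{cd}}}\,K$ is the projective dimension of $\underline{\mathbb Z}$ in the category of right Bredon modules, and $\underline{\underline{\mathrm{hd}}}\,K$ is its flat dimension, i.e. the least length of a resolution of $\underline{\mathbb Z}$ by flat right Bredon modules ($\infty$ if there is none of finite length). -/

import Mathlib

open CategoryTheory Limits Opposite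

universe u v w

/-- A group is virtually cyclic if it has a cyclic subgroup of finite index
(in particular every finite group is virtually cyclic). -/
def IsVirtuallyCyclic (G : Type u) [Group G] : Prop :=
  ∃ C : Subgroup G, IsCyclic C ∧ C.FiniteIndex

/-- The family of all virtually cyclic subgroups of `G`. -/
def vcFamily (G : Type u) [Group G] : Set (Subgroup G) :=
  {H | IsVirtuallyCyclic H}

/-- The objects `G/H`, `H ∈ F`, of the orbit category of `G` with respect to a set `F` of
subgroups of `G`. -/
structure OrbitCategory {G : Type u} [Group G] (F : Set (Subgroup G)) : Type u where
  /-- the subgroup `H` such that the object is the transitive `G`-set `G/H` -/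
  subgroup : Subgroup G
  mem : subgroup ∈ F

/-- Morphisms `G/H ⟶ G/K` in the orbit category are all `G`-equivariant maps. -/
instance OrbitCategory.category {G : Type u} [Group G] (F : Set (Subgroup G)) :
    SmallCategory (OrbitCategory F) where
  Hom X Y := (G ⧸ X.subgroup) →[G] (G ⧸ Y.subgroup)
  id X := MulActionHom.id G
  comp f g := g.comp f

/-- Right modules over a small category: contravariant functors to abelian groups. -/
abbrev RightMod (C : Type u) [SmallCategory C] : Type (u + 1) := Cᵒᵖ ⥤ ModuleCat.{u} ℤ

/-- Left modules over a small category: covariant functors to abelian groups. -/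
abbrev LeftMod (C : Type u) [SmallCategory C] : Type (u + 1) := C ⥤ ModuleCat.{u} ℤ

noncomputable section

/-- The tensor product `A ⊗_R B` of modules over a commutative ring, as a bifunctor. -/
def moduleTensor (R : Type w) [CommRing R] :
    ModuleCat.{u} R ⥤ ModuleCat.{u} R ⥤ ModuleCat.{u} R where
  obj A :=
    { obj := fun B => ModuleCat.of R (TensorProduct R A B)
      map := fun g => ModuleCat.ofHom (LinearMap.lTensor A g.hom)
      map_id := fun B => by ext : 1; simp
      map_comp := fun f g => by ext : 1; simp [LinearMap.lTensor_comp] }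
  map f :=
    { app := fun B => ModuleCat.ofHom (LinearMap.rTensor B f.hom)
      naturality := fun B B' g => by
        ext : 1
        simp [LinearMap.lTensor_comp_rTensor, LinearMap.rTensor_comp_lTensor] }
  map_id A := by ext B : 3; simp
  map_comp f g := by ext B : 3; simp [LinearMap.rTensor_comp]

instance moduleTensor_additive (R : Type w) [CommRing R] :
    (moduleTensor.{u} R).Additive where
  map_add {A A' f g} := by
    apply NatTrans.ext
    funext B
    rw [NatTrans.app_add]
    apply ModuleCat.hom_ext
    exact LinearMap.rTensor_add _ _ _

/-- The functor `M ↦ M ⊗_C N` from right modules over `C` to abelian groups, where `M ⊗_C N` is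
the categorical tensor product, i.e. the coend of the bifunctor `(c, d) ↦ M(c) ⊗_ℤ N(d)`. -/
def tensorFunctor {C : Type u} [SmallCategory C] (N : LeftMod C) :
    RightMod C ⥤ ModuleCat.{u} ℤ :=
  (Functor.whiskeringRight Cᵒᵖ (ModuleCat.{u} ℤ) (C ⥤ ModuleCat.{u} ℤ)).obj
    (moduleTensor ℤ ⋙
      (Functor.whiskeringLeft C (ModuleCat.{u} ℤ) (ModuleCat.{u} ℤ)).obj N) ⋙
  coendFunctor C (ModuleCat.{u} ℤ)

instance tensorFunctor_additive {C : Type u} [SmallCategory C] (N : LeftMod C) :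
    (tensorFunctor N).Additive where
  map_add {X Y f g} := by
    apply coend.hom_ext
    intro j
    refine (coend.ι_map _ j).trans ?_
    refine Eq.trans ?_ (Preadditive.comp_add _ _ _ _ _ _).symm
    refine Eq.trans ?_ (congrArg₂ (· + ·) (coend.ι_map _ j) (coend.ι_map _ j)).symm
    rw [← Preadditive.add_comp]
    congr 1
    change ((moduleTensor ℤ).map (f.app (op j) + g.app (op j))).app (N.obj j) = _
    rw [Functor.map_add]
    rfl

/-- There are enough projective right modules over a small category. -/
instance rightMod_enoughProjectives (C : Type u) [SmallCategory C] :
    EnoughProjectives (RightMod C) where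
  presentation M := by
    let P : Cᵒᵖ → RightMod C := fun c =>
      (evaluationLeftAdjoint (ModuleCat.{u} ℤ) c).obj (Projective.over (M.obj c))
    let a : ∀ c, P c ⟶ M := fun c =>
      ((evaluationAdjunctionRight (ModuleCat.{u} ℤ) c).homEquiv _ _).symm
        (Projective.π (M.obj c))
    have hP : ∀ c, Projective (P c) := fun c =>
      (evaluationAdjunctionRight (ModuleCat.{u} ℤ) c).map_projective _ inferInstance
    have hepi : Epi (Sigma.desc a) := by
      rw [NatTrans.epi_iff_epi_app]
      intro c
      have h1 : (evaluationAdjunctionRight (ModuleCat.{u} ℤ) c).unit.app _ ≫ (a c).app c =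
          Projective.π (M.obj c) := by
        have h := ((evaluationAdjunctionRight (ModuleCat.{u} ℤ) c).homEquiv
          (Projective.over (M.obj c)) M).apply_symm_apply (Projective.π (M.obj c))
        rwa [Adjunction.homEquiv_unit] at h
      have h2 : (Sigma.ι P c).app c ≫ (Sigma.desc a).app c = (a c).app c := by
        rw [← NatTrans.comp_app, Sigma.ι_desc]
      have h3 : Epi (Projective.π (M.obj c)) := inferInstance
      rw [← h1] at h3
      have h4 : Epi ((a c).app c) := @epi_of_epi _ _ _ _ _ _ _ h3
      rw [← h2] at h4
      exact @epi_of_epi _ _ _ _ _ ((Sigma.ι P c).app c) _ h4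
    exact ⟨{ p := ∐ P, projective := inferInstance, f := Sigma.desc a, epi := hepi }⟩

/-- `Tor_i^C(M, N)`: the `i`-th left derived functor of `? ⊗_C N`, evaluated at `M`. -/
def bredonTor {C : Type u} [SmallCategory C] (i : ℕ) (M : RightMod C) (N : LeftMod C) :
    ModuleCat.{u} ℤ :=
  ((tensorFunctor N).leftDerived i).obj M

/-- A right module is flat if it is `? ⊗_C N`-acyclic for every left module `N`. -/
def IsFlatMod {C : Type u} [SmallCategory C] (M : RightMod C) : Prop :=
  ∀ (N : LeftMod C) (i : ℕ), 0 < i → IsZero (bredonTor i M N)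

/-- `M` has a resolution `0 → P_n → ⋯ → P_0 → M → 0` of length at most `n` by flat modules:
there is a nonnegatively graded chain complex of flat modules, zero in degrees above `n`, with a
quasi-isomorphism to `M` concentrated in degree `0`. -/
def HasFlatResolutionOfLength {C : Type u} [SmallCategory C] (M : RightMod C) (n : ℕ) : Prop :=
  ∃ (P : ChainComplex (RightMod C) ℕ) (π : P ⟶ (ChainComplex.single₀ (RightMod C)).obj M),
    QuasiIso π ∧ (∀ i, IsFlatMod (P.X i)) ∧ ∀ i, n < i → IsZero (P.X i)

/-- The flat dimension of a (nonzero) right module: the least length of a flat resolution, and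
`∞` if there is no finite flat resolution. -/
def flatDimension {C : Type u} [SmallCategory C] (M : RightMod C) : ℕ∞ :=
  ⨅ (n : ℕ) (_ : HasFlatResolutionOfLength M n), (n : ℕ∞)

/-- The trivial right Bredon module: constant with value `ℤ`, all morphisms acting as the
identity. -/
def trivialModule {G : Type u} [Group G] (F : Set (Subgroup G)) : RightMod (OrbitCategory F) :=
  (Functor.const _).obj (ModuleCat.of ℤ (ULift.{u} ℤ))

/-- The Bredon cohomological dimension of `G` with respect to `F`: the projective dimension of the
trivial module. -/
def bredonCd {G : Type u} [Group G] (F : Set (Subgroup G)) : WithBot ℕ∞ :=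
  projectiveDimension (trivialModule F)

/-- The Bredon homological dimension of `G` with respect to `F`: the flat dimension of the trivial
module. -/
def bredonHd {G : Type u} [Group G] (F : Set (Subgroup G)) : ℕ∞ :=
  flatDimension (trivialModule F)

/-- The Bredon cohomological dimension of `G` for the family of virtually cyclic subgroups. -/
def vcCd (G : Type u) [Group G] : WithBot ℕ∞ := bredonCd (vcFamily G)

/-- The Bredon homological dimension of `G` for the family of virtually cyclic subgroups. -/
def vcHd (G : Type u) [Group G] : ℕ∞ := bredonHd (vcFamily G)

end

/-! Both dimensions are read off from groups `Ext(ℤ, Y)` over the orbit category. For a left module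
`N` let `N^*` be its character dual `Hom(N, ℚ/ℤ)`. Since `Hom(M ⊗ N, ℚ/ℤ) = Hom(M, N^*)` and `ℚ/ℤ`
is an injective cogenerator, `Tor_i(M, N)` vanishes for a given `i ≥ 1` iff `Ext^i(M, N^*)` does.
Hence `hd ≤ n` says that `Ext^i(ℤ, N^*) = 0` for all `i > n` and all `N` (`flatDimension_le_iff`),
while `cd ≤ n` says the same with arbitrary coefficients.

These groups are computed by the bar resolution, which is free on the nerve of the category. For a
subgroup `A`, the objects `G/H` with `H ≤ A`, together with the maps represented by elements of `A`,
form a subcategory `SubOrbit` equivalent to the orbit category of `A`. A virtually cyclic group is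
finitely generated, so the nerve of the orbit category of `G` is the directed union of the nerves of
the subcategories for the `G_λ`. Three facts then give the theorem.

Upper bound for `hd`: a chain in `⨁ N(s₀)` has finite support, so a cycle already lives over some
`G_λ` and bounds there (`subsingleton_ext_constZ_dual_of_directed`).

Lower bound for `hd`: splitting `G/K` into `A`-orbits shows that the bar resolution stays projective
when restricted to `A` (`projective_res_incl_bar`). Since `Hom(Res M, N^*) = Hom(M, (Lan N)^*)`,
vanishing over `G` implies vanishing over `A` (`subsingleton_ext_constZ_dual_of_lan`).

Bound for `cd`: a countable directed family has a cofinal increasing sequence. Along it a cocycle is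
bounded stage by stage, each solution being corrected to extend the previous one; this is the `lim¹`
argument, and it costs one degree (`subsingleton_ext_constZ_of_sequence`). -/

noncomputable section

/-! ### Character duality between Tor and Ext. -/

open Abelian in
/-- Vanishing of `Ext` in positive degree can be tested on any projective resolution. -/
theorem subsingleton_ext_iff {A : Type v} [Category.{w} A] [Abelian A] [HasExt.{w} A] {X : A}
    (P : ProjectiveResolution X) (Y : A) (j : ℕ) :
    Subsingleton (Ext X Y (j + 1)) ↔ ∀ f : P.complex.X (j + 1) ⟶ Y,
      P.complex.d (j + 2) (j + 1) ≫ f = 0 → ∃ g : P.complex.X j ⟶ Y,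
        P.complex.d (j + 1) j ≫ g = f := by
  constructor
  · intro h f hf
    exact (P.extMk_eq_zero_iff f (j + 2) rfl hf j rfl).1 (Subsingleton.elim _ _)
  · intro h
    refine ⟨fun a b => ?_⟩
    have key : ∀ a : Ext X Y (j + 1), a = 0 := fun a => by
      obtain ⟨f, hf, rfl⟩ := P.extMk_surjective a (j + 2) rfl
      exact (P.extMk_eq_zero_iff f (j + 2) rfl hf j rfl).2 (h f hf)
    rw [key a, key b]

instance rightMod_hasExt (C : Type u) [SmallCategory C] : HasExt.{u} (RightMod C) :=
  hasExt_of_enoughProjectives _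

/-- The injective cogenerator `ℚ/ℤ` of the category of abelian groups. -/
def rationalCircle : ModuleCat.{u} ℤ := ModuleCat.of ℤ (ULift.{u} (AddCircle (1 : ℚ)))

instance rationalCircle_injective : Injective rationalCircle.{u} :=
  Module.injective_object_of_injective_module
    (inj := Module.ulift_injective_of_injective ℤ
      (Module.Baer.of_divisible (AddCircle (1 : ℚ))).injective)

theorem exists_character_ne_zero {A : ModuleCat.{u} ℤ} {a : A} (ha : a ≠ 0) :
    ∃ χ : A ⟶ rationalCircle.{u}, χ.hom a ≠ 0 := by
  obtain ⟨c, hc⟩ := CharacterModule.exists_character_apply_ne_zero_of_ne_zero ha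
  let χ : A →+ ULift.{u} (AddCircle (1 : ℚ)) :=
    (AddEquiv.ulift.symm : AddCircle (1 : ℚ) ≃+ _).toAddMonoidHom.comp c
  exact ⟨ModuleCat.ofHom { χ with map_smul' := fun n x => map_intCast_smul χ ℤ ℤ n x },
    fun h => hc (congrArg ULift.down h)⟩

/-- Injectivity of `ℚ/ℤ` gives one direction. Conversely, a cycle that is not a boundary is nonzero
in the cokernel of `S.f`, so some character detects it; that character kills `S.f`, hence factors
through `S.g` and vanishes on the cycle. -/
theorem exact_iff_characters (S : ShortComplex (ModuleCat.{u} ℤ)) :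
    S.Exact ↔ ∀ φ : S.X₂ ⟶ rationalCircle.{u}, S.f ≫ φ = 0 → ∃ ψ, S.g ≫ ψ = φ := by
  constructor
  · intro h φ hφ
    exact ⟨h.descToInjective φ hφ, h.comp_descToInjective φ hφ⟩
  · intro h
    rw [ShortComplex.moduleCat_exact_iff]
    intro x hx
    by_contra hne
    have hex := (ShortComplex.moduleCat_exact_iff _).1
      (ShortComplex.exact_cokernel S.f)
    have hx' : (cokernel.π S.f).hom x ≠ 0 := fun h0 => hne (hex x h0)
    obtain ⟨χ, hχ⟩ := exists_character_ne_zero hx'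
    obtain ⟨ψ, hψ⟩ := h (cokernel.π S.f ≫ χ) (by simp)
    apply hχ
    refine (congrArg (fun k => k.hom x) hψ).symm.trans ?_
    change ψ.hom (S.g.hom x) = 0
    rw [show S.g.hom x = 0 from hx, map_zero]

/-- The tensor-hom adjunction, for maps into a fixed module `J`. -/
def tensorHomEquiv {R : Type w} [CommRing R] (A B J : ModuleCat.{u} R) :
    (((moduleTensor R).obj A).obj B ⟶ J) ≃
      (A ⟶ (((linearYoneda R (ModuleCat.{u} R)).obj J).obj (op B))) where
  toFun f := ModuleCat.ofHom
    { toFun := fun a => ModuleCat.ofHom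
        ((TensorProduct.mk R A B).compr₂ (f.hom : TensorProduct R A B →ₗ[R] J) a)
      map_add' := fun a b => by rw [map_add]; rfl
      map_smul' := fun r a => by rw [map_smul]; rfl }
  invFun φ := ModuleCat.ofHom (TensorProduct.lift
    { toFun := fun a => ModuleCat.Hom.hom (A := B) (B := J) (φ.hom a)
      map_add' := fun a b => by rw [map_add]; rfl
      map_smul' := fun r a => by rw [map_smul]; rfl })
  left_inv f := by
    apply ModuleCat.hom_ext
    apply TensorProduct.ext'
    intro a b
    rfl
  right_inv φ := by
    apply ModuleCat.hom_ext
    apply LinearMap.ext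
    intro a
    apply ModuleCat.hom_ext
    apply LinearMap.ext
    intro b
    rfl

theorem tensorHomEquiv_zero {R : Type w} [CommRing R] (A B J : ModuleCat.{u} R) :
    tensorHomEquiv A B J 0 = 0 := rfl

theorem tensorHomEquiv_comp_left {R : Type w} [CommRing R] {A A' : ModuleCat.{u} R}
    (B J : ModuleCat.{u} R) (g : A' ⟶ A) (f : ((moduleTensor R).obj A).obj B ⟶ J) :
    tensorHomEquiv A' B J (((moduleTensor R).map g).app B ≫ f) = g ≫ tensorHomEquiv A B J f := rfl

theorem tensorHomEquiv_comp_right {R : Type w} [CommRing R] (A : ModuleCat.{u} R)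
    {B B' : ModuleCat.{u} R} (J : ModuleCat.{u} R) (g : B' ⟶ B)
    (f : ((moduleTensor R).obj A).obj B ⟶ J) :
    tensorHomEquiv A B' J (((moduleTensor R).obj A).map g ≫ f) =
      tensorHomEquiv A B J f ≫ ((linearYoneda R (ModuleCat.{u} R)).obj J).map g.op := rfl

section Dual

variable {C : Type u} [SmallCategory C]

/-- The character dual of a left module: `c ↦ Hom(N(c), ℚ/ℤ)`. -/
def LeftMod.dual (N : LeftMod C) : RightMod C :=
  N.op ⋙ (linearYoneda ℤ (ModuleCat.{u} ℤ)).obj rationalCircle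

/-- The character dual of a right module: `c ↦ Hom(M(c), ℚ/ℤ)`. -/
def RightMod.dual (M : RightMod C) : LeftMod C :=
  M.rightOp ⋙ (linearYoneda ℤ (ModuleCat.{u} ℤ)).obj rationalCircle

theorem rightMod_naturality_apply {M X : RightMod C} (φ : M ⟶ X) {x y : C} (f : x ⟶ y)
    (m : M.obj (op y)) :
    (φ.app (op x)).hom ((M.map f.op).hom m) = (X.map f.op).hom ((φ.app (op y)).hom m) :=
  congrArg (fun k => k.hom m) (φ.naturality f.op)

/-- The bifunctor whose coend is the tensor product of `M` and `N`. -/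
abbrev tensorBifunctor (M : RightMod C) (N : LeftMod C) : Cᵒᵖ ⥤ C ⥤ ModuleCat.{u} ℤ :=
  M ⋙ moduleTensor ℤ ⋙ (Functor.whiskeringLeft C (ModuleCat.{u} ℤ) (ModuleCat.{u} ℤ)).obj N

/-- `Hom(M ⊗ N, ℚ/ℤ) = Hom(M, N^*)`. -/
def tensorDualEquiv (M : RightMod C) (N : LeftMod C) :
    ((tensorFunctor N).obj M ⟶ rationalCircle.{u}) ≃ (M ⟶ N.dual) where
  toFun f :=
    { app := fun c => tensorHomEquiv (M.obj c) (N.obj c.unop) rationalCircle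
        (coend.ι (tensorBifunctor M N) c.unop ≫ f)
      naturality := fun c c' g => by
        refine (tensorHomEquiv_comp_left _ _ (M.map g) _).symm.trans
          (Eq.trans ?_ (tensorHomEquiv_comp_right _ _ (N.map g.unop) _))
        exact congrArg _ (coend.condition_assoc (tensorBifunctor M N) g.unop f) }
  invFun φ := coend.desc (F := tensorBifunctor M N)
    (fun c => (tensorHomEquiv (M.obj (op c)) (N.obj c) rationalCircle).symm (φ.app (op c)))
    (fun i j g => by
      apply (tensorHomEquiv _ _ _).injective
      refine (tensorHomEquiv_comp_left _ _ (M.map g.op) _).trans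
          (Eq.trans ?_ (tensorHomEquiv_comp_right _ _ (N.map g) _).symm)
      refine (congrArg (M.map g.op ≫ ·) (Equiv.apply_symm_apply _ _)).trans
        ((φ.naturality g.op).trans ?_)
      exact congrArg (· ≫ ((linearYoneda ℤ (ModuleCat ℤ)).obj rationalCircle).map (N.map g).op)
        (Equiv.apply_symm_apply _ _).symm)
  left_inv f := by
    apply coend.hom_ext
    intro j
    rw [coend.ι_desc]
    exact Equiv.symm_apply_apply _ _
  right_inv φ := by
    apply NatTrans.ext
    funext c
    refine (congrArg (tensorHomEquiv (M.obj c) (N.obj c.unop) rationalCircle)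
      (coend.ι_desc _ _ c.unop)).trans (Equiv.apply_symm_apply _ _)

theorem tensorDualEquiv_comp {M M' : RightMod C} (N : LeftMod C) (g : M' ⟶ M)
    (f : (tensorFunctor N).obj M ⟶ rationalCircle.{u}) :
    tensorDualEquiv M' N ((tensorFunctor N).map g ≫ f) = g ≫ tensorDualEquiv M N f := by
  apply NatTrans.ext
  funext c
  refine Eq.trans ?_ (tensorHomEquiv_comp_left _ _ (g.app c) _)
  refine congrArg (tensorHomEquiv (M'.obj c) (N.obj c.unop) rationalCircle) ?_
  refine (Category.assoc _ _ _).symm.trans (Eq.trans ?_ (Category.assoc _ _ _))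
  exact congrArg (· ≫ f) (coend.ι_map (F := tensorBifunctor M' N) (F' := tensorBifunctor M N)
    _ c.unop)

theorem tensorDualEquiv_eq_zero_iff {M : RightMod C} (N : LeftMod C)
    (f : (tensorFunctor N).obj M ⟶ rationalCircle.{u}) : tensorDualEquiv M N f = 0 ↔ f = 0 := by
  have h0 : tensorDualEquiv M N 0 = 0 := by
    apply NatTrans.ext
    funext c
    exact (congrArg (tensorHomEquiv (M.obj c) (N.obj c.unop) rationalCircle) comp_zero).trans
      (tensorHomEquiv_zero _ _ _)
  rw [← h0, (tensorDualEquiv M N).apply_eq_iff_eq]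

theorem tensorFunctor_exactAt_iff (K : ChainComplex (RightMod C) ℕ) (N : LeftMod C) (j : ℕ) :
    (((tensorFunctor N).mapHomologicalComplex (ComplexShape.down ℕ)).obj K).ExactAt (j + 1) ↔
      ∀ φ : (tensorFunctor N).obj (K.X (j + 1)) ⟶ rationalCircle.{u},
        (tensorFunctor N).map (K.d (j + 2) (j + 1)) ≫ φ = 0 →
          ∃ ψ, (tensorFunctor N).map (K.d (j + 1) j) ≫ ψ = φ := by
  rw [HomologicalComplex.exactAt_iff' _ (j + 2) (j + 1) j (by simp) (by simp),
    exact_iff_characters]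
  rfl

/-- The universal coefficient principle: `Tor(M, N)` vanishes in a positive degree iff
`Ext(M, N^*)` does. -/
theorem isZero_bredonTor_iff (M : RightMod C) (N : LeftMod C) (j : ℕ) :
    IsZero (bredonTor (j + 1) M N) ↔ Subsingleton (Abelian.Ext M N.dual (j + 1)) := by
  let P : ProjectiveResolution M := ProjectiveResolution.of M
  have h1 : IsZero (bredonTor (j + 1) M N) ↔ IsZero ((((tensorFunctor N).mapHomologicalComplex
      (ComplexShape.down ℕ)).obj P.complex).homology (j + 1)) :=
    (P.isoLeftDerivedObj (tensorFunctor N) (j + 1)).isZero_iff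
  rw [subsingleton_ext_iff P, h1, ← HomologicalComplex.exactAt_iff_isZero_homology,
    tensorFunctor_exactAt_iff]
  -- Naturality of `tensorDualEquiv` turns characters of the tensored resolution into maps from the
  -- resolution to `N.dual`.
  refine (Equiv.forall_congr (tensorDualEquiv _ N) fun {φ} => ?_)
  rw [← tensorDualEquiv_comp, tensorDualEquiv_eq_zero_iff]
  refine imp_congr_right fun _ => ?_
  refine (Equiv.exists_congr (tensorDualEquiv _ N) fun {ψ} => ?_)
  rw [← tensorDualEquiv_comp, (tensorDualEquiv _ N).apply_eq_iff_eq]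

theorem isFlatMod_iff (M : RightMod C) :
    IsFlatMod M ↔ ∀ (N : LeftMod C) (j : ℕ), Subsingleton (Abelian.Ext M N.dual (j + 1)) := by
  refine forall_congr' fun N => ⟨fun h j => (isZero_bredonTor_iff M N j).1 (h _ j.succ_pos),
    fun h i hi => ?_⟩
  obtain ⟨j, rfl⟩ := Nat.exists_eq_succ_of_ne_zero hi.ne'
  exact (isZero_bredonTor_iff M N j).2 (h j)

end Dual
end

/-! ### Resolutions and dimension shifting. -/

noncomputable section

section Resolutions

variable {A : Type v} [Category.{w} A] [Abelian A]

theorem single₀_d_comp_f {K : ChainComplex A ℕ} {M : A}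
    (π : K ⟶ (ChainComplex.single₀ A).obj M) : K.d 1 0 ≫ π.f 0 = 0 := by
  rw [← π.comm 1 0, HomologicalComplex.single_obj_d, comp_zero]

theorem exactAt_succ_iff (K : ChainComplex A ℕ) (n : ℕ) : K.ExactAt (n + 1) ↔
    (ShortComplex.mk _ _ (K.d_comp_d (n + 2) (n + 1) n)).Exact :=
  HomologicalComplex.exactAt_iff' _ (n + 2) (n + 1) n (by simp) (by simp)

/-- A map to a complex concentrated in degree `0` is a quasi-isomorphism iff the augmented complex
is exact. -/
theorem quasiIso_single₀_iff {K : ChainComplex A ℕ} {M : A}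
    (π : K ⟶ (ChainComplex.single₀ A).obj M) :
    QuasiIso π ↔ ((ShortComplex.mk _ _ (single₀_d_comp_f π)).Exact ∧ Epi (π.f 0 : K.X 0 ⟶ M)) ∧
      ∀ n, (ShortComplex.mk _ _ (K.d_comp_d (n + 2) (n + 1) n)).Exact := by
  have h0 : QuasiIsoAt π 0 ↔
      (ShortComplex.mk _ _ (single₀_d_comp_f π)).Exact ∧ Epi (π.f 0 : K.X 0 ⟶ M) := by
    rw [ChainComplex.quasiIsoAt₀_iff, ShortComplex.quasiIso_iff_of_zeros']
    · exact Iff.rfl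
    all_goals first | rfl | exact HomologicalComplex.shape _ _ _ (by simp)
  have hs : ∀ n, QuasiIsoAt π (n + 1) ↔
      (ShortComplex.mk _ _ (K.d_comp_d (n + 2) (n + 1) n)).Exact := fun n => by
    rw [quasiIsoAt_iff_exactAt' _ _ (ChainComplex.exactAt_succ_single_obj _ _), exactAt_succ_iff]
  rw [quasiIso_iff]
  constructor
  · exact fun h => ⟨h0.1 (h 0), fun n => (hs n).1 (h _)⟩
  · rintro ⟨h, h'⟩ (_ | n)
    exacts [h0.2 h, (hs n).2 (h' n)]

theorem exists_quasiIso_single₀ {K : ChainComplex A ℕ} {M : A} (p : K.X 0 ⟶ M)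
    (w : K.d 1 0 ≫ p = 0) (hp : (ShortComplex.mk _ _ w).Exact) [hepi : Epi p]
    (hs : ∀ n, (ShortComplex.mk _ _ (K.d_comp_d (n + 2) (n + 1) n)).Exact) :
    ∃ π : K ⟶ (ChainComplex.single₀ A).obj M, QuasiIso π := by
  refine ⟨(ChainComplex.toSingle₀Equiv K M).symm ⟨p, w⟩, (quasiIso_single₀_iff _).2 ?_⟩
  have hf : ((ChainComplex.toSingle₀Equiv K M).symm ⟨p, w⟩).f 0 = p :=
    ChainComplex.toSingle₀Equiv_symm_apply_f_zero _ _
  -- The map is generalised to `q` because the short complex also depends on the proof `w'`; then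
  -- `hf` can be substituted.
  have key : ∀ (q : K.X 0 ⟶ M) (w' : K.d 1 0 ≫ q = 0), q = p →
      (ShortComplex.mk _ _ w').Exact ∧ Epi q := by
    rintro q w' rfl
    exact ⟨hp, hepi⟩
  exact ⟨key _ _ hf, hs⟩

/-- A resolution of the kernel of an epimorphism `X ⟶ M` gives a resolution of `M`. -/
theorem exists_quasiIso_augment {K : ChainComplex A ℕ} {M X Z : A}
    (π : K ⟶ (ChainComplex.single₀ A).obj Z) [QuasiIso π] {i : Z ⟶ X} {p : X ⟶ M}
    {w : i ≫ p = 0} (hse : (ShortComplex.mk i p w).ShortExact) :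
    ∃ (f : K.X 0 ⟶ X) (hf : K.d 1 0 ≫ f = 0)
      (π' : K.augment f hf ⟶ (ChainComplex.single₀ A).obj M), QuasiIso π' := by
  obtain ⟨⟨h0, hepi⟩, hs⟩ := (quasiIso_single₀_iff π).1 inferInstance
  have hmono : Mono i := hse.mono_f
  obtain ⟨q, hq, hqπ⟩ : ∃ (q : K.X 0 ⟶ Z) (hq : K.d 1 0 ≫ q = 0),
      (ShortComplex.mk _ _ hq).Exact ∧ Epi q := ⟨π.f 0, single₀_d_comp_f π, h0, hepi⟩
  have hqe := hqπ.2
  have hqi : K.d 1 0 ≫ q ≫ i = 0 := by rw [reassoc_of% hq, zero_comp]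
  have w' : (q ≫ i) ≫ p = 0 := by rw [Category.assoc, w, comp_zero]
  have hpe : Epi p := hse.epi_g
  have hp' : (ShortComplex.mk (q ≫ i) p w').Exact := by
    let φ : ShortComplex.mk (q ≫ i) p w' ⟶ ShortComplex.mk i p w :=
      { τ₁ := q
        τ₂ := 𝟙 _
        τ₃ := 𝟙 _ }
    have : Epi φ.τ₁ := hqe
    have : IsIso φ.τ₂ := by dsimp [φ]; infer_instance
    have : Mono φ.τ₃ := by dsimp [φ]; infer_instance
    exact (ShortComplex.exact_iff_of_epi_of_isIso_of_mono φ).2 hse.exact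
  have h1 : (ShortComplex.mk _ _ hqi).Exact := by
    let φ : ShortComplex.mk _ _ hq ⟶ ShortComplex.mk _ _ hqi :=
      { τ₁ := 𝟙 _
        τ₂ := 𝟙 _
        τ₃ := i }
    have : Epi φ.τ₁ := by dsimp [φ]; infer_instance
    have : IsIso φ.τ₂ := by dsimp [φ]; infer_instance
    have : Mono φ.τ₃ := hmono
    exact (ShortComplex.exact_iff_of_epi_of_isIso_of_mono φ).1 hqπ.1
  refine ⟨q ≫ i, hqi,
    exists_quasiIso_single₀ (K := K.augment (q ≫ i) hqi) p w' hp' (hepi := hpe) ?_⟩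
  rintro (_ | n)
  exacts [h1, hs n]

variable [HasExt.{w} A]

open Abelian

theorem subsingleton_ext_of_isZero {X : A} (hX : IsZero X) (Y : A) (i : ℕ) :
    Subsingleton (Ext X Y i) := by
  have h : ∀ e : Ext X Y i, e = 0 := fun e => by
    rw [← e.mk₀_id_comp, hX.eq_of_src (𝟙 X) 0, Ext.mk₀_zero, Ext.zero_comp]
  exact ⟨fun a b => (h a).trans (h b).symm⟩

theorem subsingleton_ext_of_iso {X X' : A} (e : X ≅ X') {Y : A} {i : ℕ}
    (h : Subsingleton (Ext X Y i)) : Subsingleton (Ext X' Y i) := by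
  have key : ∀ a : Ext X' Y i, a = 0 := fun a => by
    rw [← a.mk₀_id_comp, ← e.inv_hom_id, ← Ext.mk₀_comp_mk₀_assoc,
      Subsingleton.elim ((Ext.mk₀ e.hom).comp a (zero_add _)) 0, Ext.comp_zero]
  exact ⟨fun a b => (key a).trans (key b).symm⟩

variable {S : ShortComplex A}

theorem subsingleton_ext_left (hS : S.ShortExact) (Y : A) (i : ℕ)
    (h1 : Subsingleton (Ext S.X₂ Y i))
    (h2 : Subsingleton (Ext S.X₃ Y (i + 1))) : Subsingleton (Ext S.X₁ Y i) := by
  have key : ∀ a : Ext S.X₁ Y i, a = 0 := fun a => by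
    obtain ⟨b, rfl⟩ := Ext.contravariant_sequence_exact₁ hS Y a (add_comm 1 i)
      (Subsingleton.elim _ _)
    rw [Subsingleton.elim b 0, Ext.comp_zero]
  exact ⟨fun a b => (key a).trans (key b).symm⟩

theorem subsingleton_ext_right (hS : S.ShortExact) (Y : A) (i : ℕ)
    (h1 : Subsingleton (Ext S.X₁ Y i))
    (h2 : Subsingleton (Ext S.X₂ Y (i + 1))) : Subsingleton (Ext S.X₃ Y (i + 1)) := by
  have key : ∀ a : Ext S.X₃ Y (i + 1), a = 0 := fun a => by
    obtain ⟨b, rfl⟩ := Ext.contravariant_sequence_exact₃ hS Y a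
      (Subsingleton.elim _ _) (add_comm 1 i)
    rw [Subsingleton.elim b 0, Ext.comp_zero]
  exact ⟨fun a b => (key a).trans (key b).symm⟩

theorem subsingleton_ext_of_projective (X Y : A) [Projective X] (i : ℕ) :
    Subsingleton (Ext X Y (i + 1)) :=
  ⟨fun a b => by rw [a.eq_zero_of_projective, b.eq_zero_of_projective]⟩

/-- Dimension shifting along a finite acyclic resolution. -/
theorem subsingleton_ext_of_resolution {K : ChainComplex A ℕ} {M : A}
    (π : K ⟶ (ChainComplex.single₀ A).obj M) [QuasiIso π] (Y : A) (n : ℕ)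
    (hK : ∀ i j, Subsingleton (Ext (K.X j) Y (i + 1))) (hn : ∀ i, n < i → IsZero (K.X i))
    (i : ℕ) (hi : n < i) : Subsingleton (Ext M Y i) := by
  obtain ⟨⟨h0, hepi⟩, hs⟩ := (quasiIso_single₀_iff π).1 inferInstance
  -- All syzygies are treated at once, by induction on the degree `i`, using `0 → coker d_{j+2} →
  -- K_j → coker d_{j+1} → 0`. For `i = 0` the bound forces `K_j = 0`; the case `j = 0` is `M`
  -- itself.
  have key : ∀ i j, n < i + j → Subsingleton (Ext (cokernel (K.d (j + 1) j)) Y i) := by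
    intro i
    induction i with
    | zero =>
      intro j hj
      refine subsingleton_ext_of_isZero ?_ _ _
      exact IsZero.of_epi (cokernel.π (K.d (j + 1) j)) (hn j (by omega))
    | succ i ih =>
      intro j hj
      let m : cokernel (K.d (j + 2) (j + 1)) ⟶ K.X j :=
        cokernel.desc _ (K.d (j + 1) j) (K.d_comp_d _ _ _)
      have hm : cokernel.π (K.d (j + 2) (j + 1)) ≫ m = K.d (j + 1) j := cokernel.π_desc _ _ _
      have w : m ≫ cokernel.π (K.d (j + 1) j) = 0 := by
        rw [← cancel_epi (cokernel.π (K.d (j + 2) (j + 1))), reassoc_of% hm,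
          cokernel.condition, comp_zero]
      have hex : (ShortComplex.mk _ _ w).Exact := by
        let φ : ShortComplex.mk _ _ (cokernel.condition (K.d (j + 1) j)) ⟶
            ShortComplex.mk _ _ w :=
          { τ₁ := cokernel.π _
            τ₂ := 𝟙 _
            τ₃ := 𝟙 _
            comm₁₂ := by simpa using hm
            comm₂₃ := by simp }
        have : Epi φ.τ₁ := by dsimp [φ]; infer_instance
        have : IsIso φ.τ₂ := by dsimp [φ]; infer_instance
        have : Mono φ.τ₃ := by dsimp [φ]; infer_instance
        exact (ShortComplex.exact_iff_of_epi_of_isIso_of_mono φ).1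
          (ShortComplex.exact_cokernel (K.d (j + 1) j))
      have hmono : Mono m := (hs j).mono_cokernelDesc
      have hse : (ShortComplex.mk _ _ w).ShortExact :=
        { exact := hex, mono_f := hmono, epi_g := by dsimp; infer_instance }
      exact subsingleton_ext_right hse Y i (ih (j + 1) (by omega)) (hK i j)
  have hiso : cokernel (K.d 1 0) ≅ M :=
    (cokernelIsCokernel (K.d 1 0)).coconePointUniqueUpToIso h0.gIsCokernel
  exact subsingleton_ext_of_iso hiso (key i 0 (by simpa using hi))

end Resolutions

/-! ### Flat dimension through Ext into dual modules. -/

section Flat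

variable {C : Type u} [SmallCategory C]

open Abelian

/-- The kernel of a projective presentation of `M` satisfies the hypothesis with `n` lowered by one,
and for `n = 0` the hypothesis says that `M` is flat. Splicing the presentations gives the
resolution. -/
theorem hasFlatResolutionOfLength_of_subsingleton_ext (n : ℕ) : ∀ M : RightMod C,
    (∀ (N : LeftMod C) (j : ℕ), n ≤ j → Subsingleton (Ext M N.dual (j + 1))) →
      HasFlatResolutionOfLength M n := by
  induction n with
  | zero =>
    intro M hM
    refine ⟨(ChainComplex.single₀ _).obj M, 𝟙 _, inferInstance, ?_, ?_⟩
    · rintro (_ | i)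
      · exact (isFlatMod_iff M).2 fun N j => hM N j j.zero_le
      · exact (isFlatMod_iff _).2 fun N j => subsingleton_ext_of_isZero
          (HomologicalComplex.isZero_single_obj_X _ _ _ _ (by simp)) _ _
    · exact fun i hi => HomologicalComplex.isZero_single_obj_X _ _ _ _ (by omega)
  | succ n ih =>
    intro M hM
    have hse : (ShortComplex.mk (kernel.ι (Projective.π M)) (Projective.π M)
        (kernel.condition _)).ShortExact :=
      { exact := ShortComplex.exact_kernel _
        mono_f := by dsimp; infer_instance
        epi_g := by dsimp; infer_instance }
    obtain ⟨K, π, hπ, hflat, hz⟩ := ih (kernel (Projective.π M)) (fun N j hj =>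
      subsingleton_ext_left hse N.dual (j + 1)
        (subsingleton_ext_of_projective (Projective.over M) _ _) (hM N (j + 1) (by omega)))
    obtain ⟨f, hf, π', hπ'⟩ := exists_quasiIso_augment π hse
    refine ⟨K.augment f hf, π', hπ', ?_, ?_⟩
    · rintro (_ | i)
      · exact (isFlatMod_iff _).2 fun N j =>
          subsingleton_ext_of_projective (Projective.over M) _ _
      · exact hflat i
    · rintro (_ | i) hi
      · omega
      · exact hz i (by omega)

theorem hasFlatResolutionOfLength_iff (M : RightMod C) (n : ℕ) :
    HasFlatResolutionOfLength M n ↔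
      ∀ (N : LeftMod C) (j : ℕ), n ≤ j → Subsingleton (Ext M N.dual (j + 1)) := by
  refine ⟨?_, hasFlatResolutionOfLength_of_subsingleton_ext n M⟩
  rintro ⟨K, π, hπ, hflat, hz⟩ N j hj
  exact subsingleton_ext_of_resolution π N.dual n
    (fun i k => (isFlatMod_iff _).1 (hflat k) N i) hz (j + 1) (by omega)

theorem flatDimension_le_iff (M : RightMod C) (n : ℕ) :
    flatDimension M ≤ n ↔
      ∀ (N : LeftMod C) (j : ℕ), n ≤ j → Subsingleton (Ext M N.dual (j + 1)) := by
  rw [← hasFlatResolutionOfLength_iff]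
  constructor
  · intro h
    -- The strict bound `< n + 1` lets an actual resolution length `m ≤ n` be extracted from the
    -- infimum.
    have hlt : flatDimension M < ((n + 1 : ℕ) : ℕ∞) :=
      lt_of_le_of_lt h (by exact_mod_cast n.lt_succ_self)
    simp only [flatDimension, iInf_lt_iff] at hlt
    obtain ⟨m, hm, hmn⟩ := hlt
    rw [hasFlatResolutionOfLength_iff] at hm ⊢
    have : m < n + 1 := by exact_mod_cast hmn
    exact fun N j hj => hm N j (by omega)
  · exact fun h => iInf₂_le n h

end Flat
end

/-! ### Free right modules and their bases. -/

noncomputable section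

/-- The free abelian group on a type. -/
def freeAb (S : Type u) : ModuleCat.{u} ℤ := @ModuleCat.of ℤ _ (S →₀ ℤ) _ (Finsupp.module S ℤ)

namespace freeAb

/-- The basis elements of a free abelian group. -/
def ι {S : Type u} (s : S) : freeAb S := (Finsupp.single s 1 : S →₀ ℤ)

theorem hom_ext {S : Type u} {M : ModuleCat.{u} ℤ} {f g : freeAb S ⟶ M}
    (h : ∀ s, f.hom (ι s) = g.hom (ι s)) : f = g :=
  ModuleCat.hom_ext (Finsupp.lhom_ext' (M := ℤ) fun s => LinearMap.ext_ring (h s))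

/-- The map out of a free abelian group given by its values on the basis. -/
def desc {S : Type u} {M : ModuleCat.{u} ℤ} (f : S → M) : freeAb S ⟶ M :=
  @ModuleCat.ofHom ℤ _ _ _ _ (Finsupp.module S ℤ) _ _ (Finsupp.linearCombination ℤ f)

theorem desc_ι {S : Type u} {M : ModuleCat.{u} ℤ} (f : S → M) (s : S) :
    (desc f).hom (ι s) = f s :=
  (Finsupp.linearCombination_single ℤ 1 s).trans
    (@one_smul ℤ M _ M.isModule.toDistribMulAction.toMulAction (f s))

end freeAb

section FreeModules

variable {C : Type u} [SmallCategory C]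

/-- The map from the free abelian group on all `f : x ⟶ c a` to `M(x)` sending `f` to
`M(f)(m a)`. -/
def basisMap (M : RightMod C) {A : Type u} (c : A → C) (m : ∀ a, M.obj (op (c a))) (x : C) :
    freeAb (Σ a, (x ⟶ c a)) ⟶ M.obj (op x) :=
  freeAb.desc fun p => (M.map p.2.op).hom (m p.1)

theorem basisMap_ι (M : RightMod C) {A : Type u} (c : A → C) (m : ∀ a, M.obj (op (c a))) {x : C}
    (a : A) (f : x ⟶ c a) :
    (basisMap M c m x).hom (freeAb.ι ⟨a, f⟩) = (M.map f.op).hom (m a) := freeAb.desc_ι _ _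

/-- The family `m` is a basis of the right module `M`: every value of `M` is the free abelian
group on the images of the elements of `m`. -/
def IsModBasis (M : RightMod C) {A : Type u} (c : A → C) (m : ∀ a, M.obj (op (c a))) : Prop :=
  ∀ x, IsIso (basisMap M c m x)

namespace IsModBasis

variable {M : RightMod C} {A : Type u} {c : A → C} {m : ∀ a, M.obj (op (c a))}

theorem hom_ext (h : IsModBasis M c m) {X : RightMod C} {φ ψ : M ⟶ X}
    (hφ : ∀ a, (φ.app (op (c a))).hom (m a) = (ψ.app (op (c a))).hom (m a)) : φ = ψ := by
  apply NatTrans.ext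
  funext x
  have := h x.unop
  rw [← cancel_epi (basisMap M c m x.unop)]
  apply freeAb.hom_ext
  rintro ⟨a, f⟩
  change (φ.app x).hom ((basisMap M c m x.unop).hom (freeAb.ι ⟨a, f⟩)) =
    (ψ.app x).hom ((basisMap M c m x.unop).hom (freeAb.ι ⟨a, f⟩))
  rw [basisMap_ι]
  refine (rightMod_naturality_apply φ f (m a)).trans
    (Eq.trans ?_ (rightMod_naturality_apply ψ f (m a)).symm)
  rw [hφ]

end IsModBasis

/-- The map on free abelian groups induced by precomposition with `f`. -/
def basisPrecomp {A : Type u} (c : A → C) {x y : C} (f : x ⟶ y) :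
    freeAb (Σ a, (y ⟶ c a)) ⟶ freeAb (Σ a, (x ⟶ c a)) :=
  freeAb.desc fun p => freeAb.ι ⟨p.1, f ≫ p.2⟩

theorem basisMap_naturality (M : RightMod C) {A : Type u} (c : A → C)
    (m : ∀ a, M.obj (op (c a))) {x y : C} (f : x ⟶ y) :
    basisMap M c m y ≫ M.map f.op = basisPrecomp c f ≫ basisMap M c m x := by
  apply freeAb.hom_ext
  rintro ⟨a, g⟩
  refine (congrArg (M.map f.op).hom (basisMap_ι M c m a g)).trans
    (Eq.trans ?_ (congrArg (basisMap M c m x).hom (freeAb.desc_ι _ _)).symm)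
  refine Eq.trans ?_ (basisMap_ι M c m a (f ≫ g)).symm
  rw [op_comp, M.map_comp]
  rfl

namespace IsModBasis

variable {M : RightMod C} {A : Type u} {c : A → C} {m : ∀ a, M.obj (op (c a))}

/-- The value at `x` of the map out of a free right module given by its values on a basis. -/
def liftApp (h : IsModBasis M c m) (X : RightMod C) (y : ∀ a, X.obj (op (c a))) (x : C) :
    M.obj (op x) ⟶ X.obj (op x) :=
  have := h x
  inv (basisMap M c m x) ≫ basisMap X c y x

theorem basisMap_liftApp (h : IsModBasis M c m) (X : RightMod C) (y : ∀ a, X.obj (op (c a)))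
    (x : C) : basisMap M c m x ≫ h.liftApp X y x = basisMap X c y x :=
  have := h x
  IsIso.hom_inv_id_assoc _ _

theorem liftApp_naturality (h : IsModBasis M c m) (X : RightMod C) (y : ∀ a, X.obj (op (c a)))
    {x x' : C} (f : x ⟶ x') :
    M.map f.op ≫ h.liftApp X y x = h.liftApp X y x' ≫ X.map f.op := by
  have := h x'
  rw [← cancel_epi (basisMap M c m x'), ← Category.assoc, basisMap_naturality, Category.assoc,
    basisMap_liftApp, ← Category.assoc, basisMap_liftApp, basisMap_naturality]

/-- A map out of a free right module is given by its values on a basis. -/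
def lift (h : IsModBasis M c m) {X : RightMod C} (y : ∀ a, X.obj (op (c a))) : M ⟶ X where
  app x := h.liftApp X y x.unop
  naturality _ _ f := h.liftApp_naturality X y f.unop

theorem lift_apply (h : IsModBasis M c m) {X : RightMod C} (y : ∀ a, X.obj (op (c a))) (a : A) :
    ((h.lift y).app (op (c a))).hom (m a) = y a := by
  have key : ∀ (Y : RightMod C) (z : ∀ a, Y.obj (op (c a))),
      (basisMap Y c z (c a)).hom (freeAb.ι ⟨a, 𝟙 _⟩) = z a := fun Y z => by
    refine (basisMap_ι Y c z a (𝟙 _)).trans ?_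
    rw [op_id, Y.map_id]
    rfl
  rw [← key M m]
  exact (congrArg (fun k => k.hom (freeAb.ι ⟨a, 𝟙 _⟩)) (h.basisMap_liftApp X y (c a))).trans
    (key X y)

/-- Epimorphisms of functors are pointwise surjective, so the images of the basis elements lift
independently of one another. -/
theorem projective (h : IsModBasis M c m) : Projective M where
  factors {E X} f e he := by
    have hs : ∀ a, ∃ z : E.obj (op (c a)),
        (e.app (op (c a))).hom z = (f.app (op (c a))).hom (m a) := fun a => by
      have h1 := (NatTrans.epi_iff_epi_app e).1 he (op (c a))
      exact (ModuleCat.epi_iff_surjective _).1 h1 _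
    choose z hz using hs
    refine ⟨h.lift z, h.hom_ext fun a => ?_⟩
    rw [← hz, ← h.lift_apply z a]
    rfl

end IsModBasis

theorem rightMod_exact_iff (S : ShortComplex (RightMod C)) : S.Exact ↔
    ∀ x, ∀ m : S.X₂.obj x, (S.g.app x).hom m = 0 → ∃ l, (S.f.app x).hom l = m := by
  have h : S.Exact ↔ ∀ x, (S.map ((evaluation _ _).obj x)).Exact := by
    rw [ShortComplex.exact_iff_isZero_homology, Functor.isZero_iff]
    exact forall_congr' fun x =>
      (S.mapHomologyIso ((evaluation Cᵒᵖ (ModuleCat.{u} ℤ)).obj x)).symm.isZero_iff.trans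
        (ShortComplex.exact_iff_isZero_homology _).symm
  rw [h]
  exact forall_congr' fun x => ShortComplex.moduleCat_exact_iff _

end FreeModules

/-! ### The bar resolution of the constant module. -/

section Bar

variable {C : Type u} [SmallCategory C]

/-- Chains of `k` composable morphisms `c ⟶ c₁ ⟶ ⋯ ⟶ c_k` starting at the object `c`. -/
inductive NerveChain (C : Type u) [SmallCategory C] : ℕ → C → Type u
  | nil (c : C) : NerveChain C 0 c
  | cons {k : ℕ} {c c' : C} (f : c ⟶ c') (σ : NerveChain C k c') : NerveChain C (k + 1) c

variable (C) in
/-- The `k`-simplices of the nerve of `C`, with their initial vertex. -/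
abbrev NerveSimplex (k : ℕ) : Type u := Σ c : C, NerveChain C k c

/-- The basis of the value at `x` of the bar resolution in degree `k`. -/
abbrev BarIndex (k : ℕ) (x : C) : Type u := Σ s : NerveSimplex C k, (x ⟶ s.1)

/-- Prepending a morphism to a chain. -/
def BarIndex.cons {k : ℕ} {x : C} (p : BarIndex k x) : NerveChain C (k + 1) x :=
  NerveChain.cons p.2 p.1.2

/-- Splitting off the first morphism of a chain. -/
def NerveChain.tail {k : ℕ} {x : C} : NerveChain C (k + 1) x → BarIndex k x
  | .cons f σ => ⟨⟨_, σ⟩, f⟩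

theorem NerveChain.cons_tail {k : ℕ} {x : C} (σ : NerveChain C (k + 1) x) : σ.tail.cons = σ := by
  cases σ; rfl

variable (C) in
/-- The bar resolution of the trivial module, in degree `k`. -/
def bar (k : ℕ) : RightMod C where
  obj x := freeAb (BarIndex k x.unop)
  map f := freeAb.desc fun p => freeAb.ι ⟨p.1, f.unop ≫ p.2⟩
  map_id x := freeAb.hom_ext fun p => by
    rw [freeAb.desc_ι, unop_id, Category.id_comp]
    rfl
  map_comp f g := freeAb.hom_ext fun p => by
    change _ = (freeAb.desc _).hom ((freeAb.desc _).hom (freeAb.ι p))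
    rw [freeAb.desc_ι, freeAb.desc_ι, freeAb.desc_ι, unop_comp, Category.assoc]

/-- The basis elements of the values of the bar resolution. -/
def barElt {k : ℕ} {x : C} (p : BarIndex k x) : (bar C k).obj (op x) := freeAb.ι p

theorem bar_map_elt {k : ℕ} {x y : C} (f : x ⟶ y) (p : BarIndex k y) :
    ((bar C k).map f.op).hom (barElt p) = barElt ⟨p.1, f ≫ p.2⟩ :=
  freeAb.desc_ι _ _

/-- The generator of the bar resolution given by a simplex. -/
def barGen {k : ℕ} (s : NerveSimplex C k) : (bar C k).obj (op s.1) :=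
  barElt ⟨s, 𝟙 _⟩

theorem bar_isModBasis (k : ℕ) :
    IsModBasis (bar C k) (fun s : NerveSimplex C k => s.1) barGen := fun x => by
  have h : basisMap (bar C k) (fun s : NerveSimplex C k => s.1) barGen x = 𝟙 (freeAb _) := by
    apply freeAb.hom_ext
    rintro ⟨s, f⟩
    rw [basisMap_ι]
    refine (bar_map_elt f _).trans ?_
    rw [Category.comp_id]
    rfl
  rw [h]
  exact (inferInstance : IsIso (𝟙 (freeAb _)))

variable (C) in
/-- The constant right module `ℤ`. -/
def constZ : RightMod C := (Functor.const _).obj (ModuleCat.of ℤ (ULift.{u} ℤ))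

/-- The contraction of the bar resolution at the object `x`. -/
def barContr (k : ℕ) (x : C) : (bar C k).obj (op x) ⟶ (bar C (k + 1)).obj (op x) :=
  freeAb.desc fun p => barGen ⟨x, p.cons⟩

theorem barContr_elt (k : ℕ) (x : C) (p : BarIndex k x) :
    (barContr k x).hom (barElt p) = barGen ⟨x, p.cons⟩ := freeAb.desc_ι _ _

/-- The contraction of the bar resolution in degree `-1`. -/
def barUnit (x : C) : (constZ C).obj (op x) ⟶ (bar C 0).obj (op x) :=
  ModuleCat.ofHom (X := ULift.{u} ℤ)
    { toFun := fun n => n.down • barGen ⟨x, .nil x⟩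
      map_add' := fun _ _ => add_smul _ _ _
      map_smul' := fun _ _ => mul_smul _ _ _ }

variable (C) in
/-- The augmentation of the bar resolution. -/
def barAug : bar C 0 ⟶ constZ C :=
  (bar_isModBasis 0).lift fun _ => (ULift.up 1 : ULift.{u} ℤ)

/-- The differential of the bar resolution, determined by the contraction. -/
def barD : ∀ k, bar C (k + 1) ⟶ bar C k
  -- A generator in positive degree is the contraction `h` of its tail, so the homotopy identity `d
  -- h = 1 - h d` is taken as the definition of `d`. No alternating sum of faces is needed.
  | 0 => (bar_isModBasis 1).lift fun s =>
      (𝟙 _ - (barAug C).app (op s.1) ≫ barUnit s.1).hom (barElt s.2.tail)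
  | k + 1 => (bar_isModBasis (k + 2)).lift fun s =>
      (𝟙 _ - (barD k).app (op s.1) ≫ barContr k s.1).hom (barElt s.2.tail)

theorem barD_contr_zero (x : C) : barContr 0 x ≫ (barD 0).app (op x) =
    𝟙 _ - (barAug C).app (op x) ≫ barUnit x :=
  freeAb.hom_ext fun p => by
    refine (congrArg ((barD 0).app (op x)).hom (barContr_elt 0 x p)).trans ?_
    exact (bar_isModBasis 1).lift_apply (X := bar C 0) _ ⟨x, p.cons⟩

theorem barD_contr_succ (k : ℕ) (x : C) : barContr (k + 1) x ≫ (barD (k + 1)).app (op x) =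
    𝟙 _ - (barD k).app (op x) ≫ barContr k x :=
  freeAb.hom_ext fun p => by
    refine (congrArg ((barD (k + 1)).app (op x)).hom (barContr_elt (k + 1) x p)).trans ?_
    exact (bar_isModBasis (k + 2)).lift_apply (X := bar C (k + 1)) _ ⟨x, p.cons⟩

theorem barUnit_aug (x : C) : barUnit x ≫ (barAug C).app (op x) = 𝟙 _ := by
  apply ModuleCat.hom_ext
  apply LinearMap.ext
  rintro ⟨n⟩
  change ((barAug C).app (op x)).hom (n • (barGen ⟨x, .nil x⟩ : (bar C 0).obj (op x))) = _
  rw [map_zsmul]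
  refine (congrArg (n • ·) ((bar_isModBasis 0).lift_apply _ ⟨x, .nil x⟩)).trans ?_
  exact congrArg ULift.up (mul_one n)

theorem barContr_tail {k : ℕ} (s : NerveSimplex C (k + 1)) :
    (barContr k s.1).hom (barElt s.2.tail) = barGen s := by
  rw [barContr_elt, NerveChain.cons_tail]

/-- Maps out of the bar resolution in positive degree agree if they agree after composition with
the contractions. -/
theorem bar_hom_ext {k : ℕ} {X : RightMod C} {φ ψ : bar C (k + 1) ⟶ X}
    (h : ∀ x, barContr k x ≫ φ.app (op x) = barContr k x ≫ ψ.app (op x)) : φ = ψ := by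
  refine (bar_isModBasis (k + 1)).hom_ext fun s => ?_
  rw [← barContr_tail]
  exact congrArg (fun g => g.hom (barElt s.2.tail)) (h s.1)

theorem barD_aug : barD 0 ≫ barAug C = 0 := by
  apply bar_hom_ext
  intro x
  rw [NatTrans.comp_app, ← Category.assoc, barD_contr_zero, Preadditive.sub_comp,
    Category.id_comp, Category.assoc, barUnit_aug, Category.comp_id, sub_self]
  exact comp_zero.symm

/-- It suffices to test on the image of the contraction `h`. There `d d h = d (1 - h d) = d - (1 - h
d) d`, which is zero by the previous case. -/
theorem barD_comp (k : ℕ) : barD (C := C) (k + 1) ≫ barD k = 0 := by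
  induction k with
  | zero =>
    apply bar_hom_ext
    intro x
    have h0 : (barD 0).app (op x) ≫ (barAug C).app (op x) = 0 :=
      NatTrans.congr_app barD_aug (op x)
    rw [NatTrans.comp_app, ← Category.assoc, barD_contr_succ, Preadditive.sub_comp,
      Category.id_comp, Category.assoc, barD_contr_zero, Preadditive.comp_sub, reassoc_of% h0,
      Category.comp_id, zero_comp, sub_zero, sub_self]
    exact comp_zero.symm
  | succ k ih =>
    apply bar_hom_ext
    intro x
    have h0 : (barD (k + 1)).app (op x) ≫ (barD k).app (op x) = 0 :=
      NatTrans.congr_app ih (op x)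
    rw [NatTrans.comp_app, ← Category.assoc, barD_contr_succ, Preadditive.sub_comp,
      Category.id_comp, Category.assoc, barD_contr_succ, Preadditive.comp_sub, reassoc_of% h0,
      Category.comp_id, zero_comp, sub_zero, sub_self]
    exact comp_zero.symm

theorem bar_exact_zero : (ShortComplex.mk _ _ (barD_aug (C := C))).Exact := by
  rw [rightMod_exact_iff]
  intro x m hm
  refine ⟨(barContr 0 x.unop).hom m, ?_⟩
  refine (congrArg (fun g => g.hom m) (barD_contr_zero x.unop)).trans ?_
  change m - (barUnit x.unop).hom (((barAug C).app x).hom m) = m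
  rw [show ((barAug C).app x).hom m = 0 from hm, map_zero]
  exact sub_zero m

theorem bar_exact_succ (k : ℕ) : (ShortComplex.mk _ _ (barD_comp (C := C) k)).Exact := by
  rw [rightMod_exact_iff]
  intro x m hm
  refine ⟨(barContr (k + 1) x.unop).hom m, ?_⟩
  refine (congrArg (fun g => g.hom m) (barD_contr_succ k x.unop)).trans ?_
  change m - (barContr k x.unop).hom (((barD k).app x).hom m) = m
  rw [show ((barD k).app x).hom m = 0 from hm, map_zero]
  exact sub_zero m

instance barAug_epi : Epi (barAug C) := by
  rw [NatTrans.epi_iff_epi_app]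
  intro x
  have h : barUnit x.unop ≫ (barAug C).app x = 𝟙 _ := barUnit_aug x.unop
  exact (SplitEpi.mk _ h).epi

end Bar

/-! ### Ext of the constant module by bar cochains. -/

section Criterion

open Abelian

/-- Vanishing of `Ext` in positive degree can be tested on any exact sequence of projectives. -/
theorem subsingleton_ext_iff_of_exact {A : Type v} [Category.{w} A] [Abelian A] [HasExt.{w} A]
    {M : A} {X : ℕ → A} {d : ∀ n, X (n + 1) ⟶ X n} {sq : ∀ n, d (n + 1) ≫ d n = 0}
    (hX : ∀ n, Projective (X n)) {p : X 0 ⟶ M} {w : d 0 ≫ p = 0}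
    (h0 : (ShortComplex.mk _ _ w).Exact) (hp : Epi p)
    (hs : ∀ n, (ShortComplex.mk _ _ (sq n)).Exact) (Y : A) (j : ℕ) :
    Subsingleton (Ext M Y (j + 1)) ↔
      ∀ f : X (j + 1) ⟶ Y, d (j + 1) ≫ f = 0 → ∃ g : X j ⟶ Y, d j ≫ g = f := by
  let K : ChainComplex A ℕ := ChainComplex.of X d sq
  have hd : ∀ n, K.d (n + 1) n = d n := ChainComplex.of_d _ _
  have hex : ∀ n, (ShortComplex.mk _ _ (K.d_comp_d (n + 2) (n + 1) n)).Exact := fun n => by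
    have h := hs n
    simp only [← hd] at h
    exact h
  have w' : K.d 1 0 ≫ p = 0 := by rw [hd]; exact w
  have h0' : (ShortComplex.mk _ _ w').Exact := by
    simp only [← hd] at h0
    exact h0
  obtain ⟨π, hπ⟩ := exists_quasiIso_single₀ (K := K) p w' h0' (hepi := hp) hex
  let P : ProjectiveResolution M := { complex := K, π := π, projective := hX }
  have := subsingleton_ext_iff P Y j
  simp only [P, hd] at this
  exact this

variable {C : Type u} [SmallCategory C]

theorem subsingleton_ext_constZ_iff (Y : RightMod C) (j : ℕ) :
    Subsingleton (Ext (constZ C) Y (j + 1)) ↔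
      ∀ f : bar C (j + 1) ⟶ Y, barD (j + 1) ≫ f = 0 → ∃ g, barD j ≫ g = f :=
  subsingleton_ext_iff_of_exact (sq := barD_comp) (fun n => (bar_isModBasis n).projective)
    bar_exact_zero inferInstance bar_exact_succ Y j

/-- Restriction of right modules along a functor. -/
abbrev resMod {D : Type u} [SmallCategory D] (J : D ⥤ C) : RightMod C ⥤ RightMod D :=
  (Functor.whiskeringLeft Dᵒᵖ Cᵒᵖ (ModuleCat.{u} ℤ)).obj J.op

theorem barAug_res_epi {D : Type u} [SmallCategory D] (J : D ⥤ C) :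
    Epi ((resMod J).map (barAug C)) := by
  rw [NatTrans.epi_iff_epi_app]
  exact fun x => (NatTrans.epi_iff_epi_app _).1 (barAug_epi (C := C)) (op (J.obj x.unop))

/-- Exactness is pointwise and the constant module restricts to the constant module, so projectivity
is all that the restricted bar resolution needs in order to compute Ext over `D`. -/
theorem subsingleton_ext_constZ_res_iff {D : Type u} [SmallCategory D] (J : D ⥤ C)
    (hJ : ∀ k, Projective ((resMod J).obj (bar C k))) (Y : RightMod D) (j : ℕ) :
    Subsingleton (Ext (constZ D) Y (j + 1)) ↔
      ∀ f : (resMod J).obj (bar C (j + 1)) ⟶ Y, (resMod J).map (barD (j + 1)) ≫ f = 0 →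
        ∃ g, (resMod J).map (barD j) ≫ g = f := by
  refine subsingleton_ext_iff_of_exact (M := constZ D) (d := fun n => (resMod J).map (barD n))
    (sq := fun n => ?_) hJ (p := (resMod J).map (barAug C)) (w := ?_) ?_ ?_ ?_ Y j
  · rw [← Functor.map_comp, barD_comp, Functor.map_zero]
  · exact (Functor.map_comp _ _ _).symm.trans
      ((congrArg (resMod J).map barD_aug).trans (Functor.map_zero _ _ _))
  · rw [rightMod_exact_iff]
    exact fun x => (rightMod_exact_iff _).1 bar_exact_zero (op (J.obj x.unop))
  · exact barAug_res_epi J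
  · intro n
    rw [rightMod_exact_iff]
    exact fun x => (rightMod_exact_iff _).1 (bar_exact_succ n) (op (J.obj x.unop))

end Criterion
end

/-! ### Functoriality of the bar resolution and restriction of cochains. -/

noncomputable section

section Functoriality

variable {C D : Type u} [SmallCategory C] [SmallCategory D] (J : D ⥤ C)

/-- The image of a chain of morphisms under a functor. -/
def NerveChain.map : ∀ {k : ℕ} {c : D}, NerveChain D k c → NerveChain C k (J.obj c)
  | _, _, .nil c => .nil (J.obj c)
  | _, _, .cons f σ => .cons (J.map f) (σ.map)

/-- The map on nerves induced by a functor. -/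
def nerveSimplexMap {k : ℕ} (s : NerveSimplex D k) : NerveSimplex C k := ⟨J.obj s.1, s.2.map J⟩

/-- The comparison map of bar resolutions induced by a functor. -/
def barMap (k : ℕ) : bar D k ⟶ (resMod J).obj (bar C k) :=
  (bar_isModBasis k).lift fun s => barGen (nerveSimplexMap J s)

theorem barMap_gen {k : ℕ} (s : NerveSimplex D k) :
    ((barMap J k).app (op s.1)).hom (barGen s) = barGen (nerveSimplexMap J s) :=
  (bar_isModBasis k).lift_apply (X := (resMod J).obj (bar C k)) _ s

theorem barElt_eq_map_gen {k : ℕ} {x : C} (p : BarIndex k x) :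
    barElt p = ((bar C k).map p.2.op).hom (barGen p.1) := by
  refine Eq.trans ?_ (bar_map_elt p.2 _).symm
  rw [Category.comp_id]

theorem barMap_elt {k : ℕ} {x : D} (p : BarIndex k x) :
    ((barMap J k).app (op x)).hom (barElt p) =
      barElt ⟨nerveSimplexMap J p.1, J.map p.2⟩ := by
  rw [barElt_eq_map_gen]
  refine (rightMod_naturality_apply (barMap J k) p.2 (barGen p.1)).trans ?_
  refine (congrArg _ (barMap_gen J p.1)).trans ?_
  exact (barElt_eq_map_gen (C := C) (k := k) ⟨nerveSimplexMap J p.1, J.map p.2⟩).symm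

theorem barContr_barMap (k : ℕ) (x : D) :
    barContr k x ≫ (barMap J (k + 1)).app (op x) =
      (barMap J k).app (op x) ≫ barContr k (J.obj x) :=
  freeAb.hom_ext fun p => by
    refine (congrArg ((barMap J (k + 1)).app (op x)).hom (barContr_elt k x p)).trans ?_
    refine (barMap_gen J ⟨x, p.cons⟩).trans ?_
    refine Eq.trans ?_ (congrArg (barContr k (J.obj x)).hom (barMap_elt J p)).symm
    exact (barContr_elt k (J.obj x) ⟨nerveSimplexMap J p.1, J.map p.2⟩).symm

theorem barAug_gen (s : NerveSimplex C 0) :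
    ((barAug C).app (op s.1)).hom (barGen s) = (ULift.up 1 : ULift.{u} ℤ) :=
  (bar_isModBasis 0).lift_apply (X := constZ C) _ s

theorem barMap_aug : barMap J 0 ≫ (resMod J).map (barAug C) = barAug D :=
  (bar_isModBasis 0).hom_ext fun s => by
    refine (congrArg ((barAug C).app (op (J.obj s.1))).hom (barMap_gen J s)).trans ?_
    exact (barAug_gen (nerveSimplexMap J s)).trans (barAug_gen s).symm

theorem barUnit_barMap (x : D) :
    barUnit x ≫ (barMap J 0).app (op x) = barUnit (J.obj x) := by
  apply ModuleCat.hom_ext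
  apply LinearMap.ext
  rintro ⟨n⟩
  change ((barMap J 0).app (op x)).hom (n • (barGen ⟨x, .nil x⟩ : (bar D 0).obj (op x))) = _
  rw [map_zsmul]
  exact congrArg (n • ·) (barMap_gen J ⟨x, .nil x⟩)

/-- The comparison maps commute with the contractions, and these determine the differentials, so the
identity follows by induction on the degree. -/
theorem barMap_barD (k : ℕ) :
    barMap J (k + 1) ≫ (resMod J).map (barD k) = barD k ≫ barMap J k := by
  induction k with
  | zero =>
    apply bar_hom_ext
    intro x
    have h1 := congrArg (· ≫ (barD 0).app (op (J.obj x))) (barContr_barMap J 0 x)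
    have h2 := congrArg (· ≫ (barMap J 0).app (op x)) (barD_contr_zero x)
    have h3 : (barMap J 0).app (op x) ≫ (barAug C).app (op (J.obj x)) = (barAug D).app (op x) :=
      NatTrans.congr_app (barMap_aug J) (op x)
    simp only [Category.assoc, Preadditive.sub_comp, Category.id_comp] at h1 h2
    refine h1.trans (Eq.trans ?_ h2.symm)
    rw [barD_contr_zero, Preadditive.comp_sub, barUnit_barMap, ← h3]
    exact congrArg₂ (· - ·) (Category.comp_id _) (Category.assoc _ _ _).symm
  | succ k ih =>
    apply bar_hom_ext
    intro x
    have h1 := congrArg (· ≫ (barD (k + 1)).app (op (J.obj x))) (barContr_barMap J (k + 1) x)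
    have h2 := congrArg (· ≫ (barMap J (k + 1)).app (op x)) (barD_contr_succ k x)
    have h3 : (barMap J (k + 1)).app (op x) ≫ (barD k).app (op (J.obj x)) =
        (barD k).app (op x) ≫ (barMap J k).app (op x) := NatTrans.congr_app ih (op x)
    simp only [Category.assoc, Preadditive.sub_comp, Category.id_comp] at h1 h2
    refine h1.trans (Eq.trans ?_ h2.symm)
    rw [barD_contr_succ, Preadditive.comp_sub, barContr_barMap, ← Category.assoc, h3,
      Category.assoc]
    exact congrArg (· - _) (Category.comp_id _)

/-- Restriction of cochains along a functor. -/
def resCochain {k : ℕ} {X : RightMod C} (φ : bar C k ⟶ X) : bar D k ⟶ (resMod J).obj X :=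
  barMap J k ≫ (resMod J).map φ

theorem resCochain_gen {k : ℕ} {X : RightMod C} (φ : bar C k ⟶ X) (s : NerveSimplex D k) :
    ((resCochain J φ).app (op s.1)).hom (barGen s) =
      (φ.app (op (J.obj s.1))).hom (barGen (nerveSimplexMap J s)) :=
  congrArg (φ.app (op (J.obj s.1))).hom (barMap_gen J s)

theorem resCochain_barD {k : ℕ} {X : RightMod C} (φ : bar C k ⟶ X) :
    resCochain J (barD k ≫ φ) = barD k ≫ resCochain J φ := by
  rw [resCochain, Functor.map_comp, ← Category.assoc, barMap_barD, Category.assoc]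
  rfl

theorem resCochain_sub {k : ℕ} {X : RightMod C} (φ ψ : bar C k ⟶ X) :
    resCochain J (φ - ψ) = resCochain J φ - resCochain J ψ := by
  rw [resCochain, Functor.map_sub, Preadditive.comp_sub]
  rfl

/-- A cochain is an arbitrary function on simplices, and restriction retains exactly its values on
the image of the nerve of `D`. -/
theorem resCochain_eq_iff {k : ℕ} {X : RightMod C} {φ ψ : bar C k ⟶ X} :
    resCochain J φ = resCochain J ψ ↔ ∀ s : NerveSimplex C k, s ∈ Set.range (nerveSimplexMap J) →
      (φ.app (op s.1)).hom (barGen s) = (ψ.app (op s.1)).hom (barGen s) := by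
  constructor
  · rintro h _ ⟨s, rfl⟩
    refine (resCochain_gen J φ s).symm.trans (Eq.trans ?_ (resCochain_gen J ψ s))
    rw [h]
  · intro h
    refine (bar_isModBasis k).hom_ext fun s => ?_
    rw [resCochain_gen, resCochain_gen]
    exact h _ ⟨s, rfl⟩

theorem exists_extension_of_injective {α β : Type*} {γ : β → Type*} [∀ b, Inhabited (γ b)]
    {j : α → β} (hj : Function.Injective j) (z : ∀ a, γ (j a)) :
    ∃ y : ∀ b, γ b, ∀ a, y (j a) = z a := by
  classical
  refine ⟨fun b => if h : ∃ a, j a = b then h.choose_spec ▸ z h.choose else default, fun a => ?_⟩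
  have h : ∃ a', j a' = j a := ⟨a, rfl⟩
  refine (dif_pos h).trans ?_
  have key : ∀ (a' : α) (e : j a' = j a), (e ▸ z a' : γ (j a)) = z a := by
    intro a' e
    obtain rfl := hj e
    rfl
  exact key _ _

theorem resCochain_surjective {k : ℕ} (X : RightMod C)
    (hJ : Function.Injective (nerveSimplexMap (k := k) J)) :
    Function.Surjective (resCochain J : (bar C k ⟶ X) → _) := by
  intro h
  -- Cochains are extended by zero off the image of the nerve of `D`.
  have : ∀ s : NerveSimplex C k, Inhabited (X.obj (op s.1)) := fun s => ⟨0⟩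
  obtain ⟨y, hy⟩ := exists_extension_of_injective (γ := fun s => X.obj (op s.1)) hJ
    (fun t => (h.app (op t.1)).hom (barGen t))
  refine ⟨(bar_isModBasis k).lift y, (bar_isModBasis k).hom_ext fun s => ?_⟩
  rw [resCochain_gen]
  exact ((bar_isModBasis k).lift_apply y (nerveSimplexMap J s)).trans (hy s)

open Abelian

/-- Here `f` is a cocycle only over `D`. The cochain bounding it there extends to `C`, which lets
all stages of a limit argument work with cochains on the one category `C`. -/
theorem exists_resCochain_eq {j : ℕ} {X : RightMod C}
    (hJ : Function.Injective (nerveSimplexMap (k := j) J))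
    (hext : Subsingleton (Ext (constZ D) ((resMod J).obj X) (j + 1)))
    (f : bar C (j + 1) ⟶ X) (hf : resCochain J (barD (j + 1) ≫ f) = 0) :
    ∃ g : bar C j ⟶ X, resCochain J (barD j ≫ g) = resCochain J f := by
  obtain ⟨g', hg'⟩ := (subsingleton_ext_constZ_iff _ _).1 hext (resCochain J f)
    ((resCochain_barD J f).symm.trans hf)
  obtain ⟨g, rfl⟩ := resCochain_surjective J X hJ g'
  exact ⟨g, (resCochain_barD J g).trans hg'⟩

end Functoriality

/-! ### Cohomology of an increasing union: the `lim¹` argument. -/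

section Sequential

variable {C : Type u} [SmallCategory C] {D : ℕ → Type u} [∀ n, SmallCategory (D n)]
  (J : ∀ n, D n ⥤ C)

open Abelian

/-- If the nerve of `C` is the increasing union of the nerves of the categories `D n`, then the
vanishing of cohomology of the `D n` implies the vanishing of the cohomology of `C`, with a loss of
one degree. -/
theorem subsingleton_ext_constZ_of_sequence
    (hinj : ∀ n k, Function.Injective (nerveSimplexMap (k := k) (J n)))
    (hmono : ∀ n k, Set.range (nerveSimplexMap (k := k) (J n)) ⊆
      Set.range (nerveSimplexMap (k := k) (J (n + 1))))
    (hcover : ∀ k (s : NerveSimplex C k), ∃ n, s ∈ Set.range (nerveSimplexMap (J n)))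
    (X : RightMod C) (k : ℕ)
    (h1 : ∀ n, Subsingleton (Ext (constZ (D n)) ((resMod (J n)).obj X) (k + 1)))
    (h2 : ∀ n, Subsingleton (Ext (constZ (D n)) ((resMod (J n)).obj X) (k + 2))) :
    Subsingleton (Ext (constZ C) X (k + 2)) := by
  rw [subsingleton_ext_constZ_iff]
  intro f hf
  have hz : ∀ (n : ℕ) {k : ℕ}, resCochain (J n) (0 : bar C k ⟶ X) = 0 := fun n k => by
    rw [← sub_self (0 : bar C k ⟶ X), resCochain_sub, sub_self]
  have hle : ∀ {m n : ℕ}, m ≤ n → ∀ {k : ℕ} {φ ψ : bar C k ⟶ X},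
      resCochain (J n) φ = resCochain (J n) ψ → resCochain (J m) φ = resCochain (J m) ψ := by
    intro m n hmn
    induction hmn with
    | refl => exact fun h => h
    | step _ ih =>
      intro k φ ψ h
      refine ih ?_
      rw [resCochain_eq_iff] at h ⊢
      exact fun s hs => h s (hmono _ _ hs)
  let P : ℕ → (bar C (k + 1) ⟶ X) → Prop := fun n g =>
    resCochain (J n) (barD (k + 1) ≫ g) = resCochain (J n) f
  have hex : ∀ n, ∃ g, P n g := fun n =>
    exists_resCochain_eq (J n) (hinj _ _) (h2 n) f (by rw [hf, hz])
  -- Two solutions at stage `n` differ there by a cocycle in degree `k + 1`, which `h1` bounds by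
  -- some `e`. Subtracting the coboundary of `e` from the solution at stage `n + 1` makes it agree
  -- with `g` at stage `n`.
  have hstep : ∀ n (g : {g // P n g}), ∃ g' : {g // P (n + 1) g},
      resCochain (J n) g'.1 = resCochain (J n) g.1 := by
    rintro n ⟨g, hg⟩
    obtain ⟨g', hg'⟩ := hex (n + 1)
    obtain ⟨e, he⟩ := exists_resCochain_eq (J n) (hinj n k) (h1 n) (g' - g) (by
      rw [Preadditive.comp_sub, resCochain_sub, hle (Nat.le_succ n) hg', hg, sub_self])
    refine ⟨⟨g' - barD k ≫ e, ?_⟩, ?_⟩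
    · change resCochain _ _ = _
      rw [Preadditive.comp_sub, ← Category.assoc, barD_comp, zero_comp, sub_zero]
      exact hg'
    · rw [resCochain_sub, he, resCochain_sub, sub_sub_cancel]
  choose next hnext using hstep
  let g₀ : {g // P 0 g} := ⟨(hex 0).choose, (hex 0).choose_spec⟩
  let seq : ∀ n, {g // P n g} := fun n => Nat.rec g₀ next n
  have hseq : ∀ {m n : ℕ}, m ≤ n →
      resCochain (J m) (seq n).1 = resCochain (J m) (seq m).1 := by
    intro m n hmn
    induction hmn with
    | refl => rfl
    | step h ih => exact (hle h (hnext _ _)).trans ih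
  choose lev hlev using hcover (k + 1)
  -- The compatible solutions are glued by evaluating each simplex at some stage that contains it.
  let g : bar C (k + 1) ⟶ X := (bar_isModBasis (k + 1)).lift fun s =>
    ((seq (lev s)).1.app (op s.1)).hom (barGen s)
  have hg : ∀ n, resCochain (J n) g = resCochain (J n) (seq n).1 := by
    intro n
    rw [resCochain_eq_iff]
    intro s hs
    refine ((bar_isModBasis (k + 1)).lift_apply (X := X) _ s).trans ?_
    rcases le_total (lev s) n with h | h
    · exact ((resCochain_eq_iff _).1 (hseq h) s (hlev s)).symm
    · exact (resCochain_eq_iff _).1 (hseq h) s hs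
  refine ⟨g, (bar_isModBasis (k + 2)).hom_ext fun s => ?_⟩
  obtain ⟨n, hn⟩ := hcover _ s
  refine (resCochain_eq_iff (J n)).1 ?_ s hn
  rw [resCochain_barD, hg, ← resCochain_barD]
  exact (seq n).2

end Sequential
end

/-! ### Direct sums and chains on the nerve. -/

noncomputable section

section DirectSums

variable {R : Type} [CommRing R] {S : Type u}

/-- The direct sum of a family of modules. -/
def directSumMod (M : S → ModuleCat.{u} R) : ModuleCat.{u} R := ModuleCat.of R (Π₀ s, M s)

namespace directSumMod

variable {M : S → ModuleCat.{u} R}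

open Classical in
/-- The inclusion of a summand. -/
def ι (s : S) : M s ⟶ directSumMod M :=
  ModuleCat.ofHom (DFinsupp.lsingle (M := fun s => M s) s)

theorem hom_ext {T : ModuleCat.{u} R} {f g : directSumMod M ⟶ T}
    (h : ∀ s, ι s ≫ f = ι s ≫ g) : f = g := by
  classical
  refine ModuleCat.hom_ext (DFinsupp.lhom_ext' (M := fun s => M s) fun s => ?_)
  exact congrArg ModuleCat.Hom.hom (h s)

open Classical in
/-- A map out of a direct sum is given by its restrictions to the summands. -/
def desc {T : ModuleCat.{u} R} (f : ∀ s, M s ⟶ T) : directSumMod M ⟶ T :=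
  ModuleCat.ofHom (X := Π₀ s, M s) (DFinsupp.lsum R fun s => (f s).hom)

theorem ι_desc {T : ModuleCat.{u} R} (f : ∀ s, M s ⟶ T) (s : S) : ι s ≫ desc f = f s := by
  classical
  apply ModuleCat.hom_ext
  apply LinearMap.ext
  intro n
  exact DFinsupp.lsum_single (M := fun s => M s) R (fun s => (f s).hom) s n

theorem exists_finset (z : directSumMod M) : ∃ F : Finset S, ∀ T : Submodule R (directSumMod M),
    (∀ s ∈ F, ∀ n : M s, (ι s).hom n ∈ T) → z ∈ T := by
  classical
  let y : Π₀ s, M s := z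
  refine ⟨y.support, fun T hT => ?_⟩
  have h : (y.sum fun s n => (ι (M := M) s).hom n) = z := DFinsupp.sum_single (f := y)
  rw [← h]
  exact Submodule.sum_mem _ fun s hs => hT s hs _

/-- Forgetting the components outside the range of `j` gives the retraction. It makes the map on
chains induced by an inclusion of nerves injective. -/
theorem exists_retraction {S' : Type u} {j : S' → S} (hj : Function.Injective j) :
    ∃ r : directSumMod M ⟶ directSumMod (fun t => M (j t)),
      ∀ t, ι (j t) ≫ r = ι (M := fun t => M (j t)) t := by
  classical
  refine ⟨ModuleCat.ofHom (X := Π₀ s, M s) (Y := Π₀ t, M (j t))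
    { toFun := DFinsupp.comapDomain j hj
      map_add' := DFinsupp.comapDomain_add _ _
      map_smul' := DFinsupp.comapDomain_smul _ _ }, fun t => ?_⟩
  apply ModuleCat.hom_ext
  apply LinearMap.ext
  intro n
  exact DFinsupp.comapDomain_single (β := fun s => M s) j hj t n

end directSumMod

end DirectSums

section ChainGroups

variable {C : Type u} [SmallCategory C]

/-- The right module `c ↦ Hom(N(c), T)`. -/
def LeftMod.homTo (N : LeftMod C) : ModuleCat.{u} ℤ ⥤ RightMod C :=
  linearYoneda ℤ (ModuleCat.{u} ℤ) ⋙ (Functor.whiskeringLeft _ _ _).obj N.op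

/-- The group `⨁_s N(s₀)` of `k`-chains on the nerve of `C` with coefficients in `N`. -/
def chainGroup (N : LeftMod C) (k : ℕ) : ModuleCat.{u} ℤ :=
  directSumMod fun s : NerveSimplex C k => N.obj s.1

namespace chainGroup

variable {N : LeftMod C} {k : ℕ}

/-- The inclusion of a summand of the group of chains. -/
def ι (s : NerveSimplex C k) : N.obj s.1 ⟶ chainGroup N k :=
  directSumMod.ι (M := fun s : NerveSimplex C k => N.obj s.1) s

theorem hom_ext {T : ModuleCat.{u} ℤ} {f g : chainGroup N k ⟶ T} (h : ∀ s, ι s ≫ f = ι s ≫ g) :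
    f = g := directSumMod.hom_ext h

/-- A map out of the group of chains is given by its restrictions to the summands. -/
def desc {T : ModuleCat.{u} ℤ} (f : ∀ s : NerveSimplex C k, N.obj s.1 ⟶ T) :
    chainGroup N k ⟶ T := directSumMod.desc f

theorem ι_desc {T : ModuleCat.{u} ℤ} (f : ∀ s : NerveSimplex C k, N.obj s.1 ⟶ T)
    (s : NerveSimplex C k) : ι s ≫ desc f = f s := directSumMod.ι_desc f s

variable (N k) in
/-- The universal cochain. -/
def univ : bar C k ⟶ N.homTo.obj (chainGroup N k) :=
  (bar_isModBasis k).lift fun s => (ι s : N.obj s.1 ⟶ chainGroup N k)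

theorem univ_gen (s : NerveSimplex C k) :
    ((univ N k).app (op s.1)).hom (barGen s) = (ι s : N.obj s.1 ⟶ chainGroup N k) :=
  (bar_isModBasis k).lift_apply (X := N.homTo.obj (chainGroup N k)) _ s

/-- The group of chains corepresents cochains. -/
def homEquiv (T : ModuleCat.{u} ℤ) : (chainGroup N k ⟶ T) ≃ (bar C k ⟶ N.homTo.obj T) where
  toFun ψ := univ N k ≫ N.homTo.map ψ
  invFun φ := desc fun s => ((φ.app (op s.1)).hom (barGen s) : N.obj s.1 ⟶ T)
  left_inv ψ := hom_ext fun s => (ι_desc _ s).trans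
    (congrArg (fun z : N.obj s.1 ⟶ chainGroup N k => z ≫ ψ) (univ_gen s))
  right_inv _ := (bar_isModBasis k).hom_ext fun s =>
    (congrArg (fun z : N.obj s.1 ⟶ chainGroup N k => z ≫ desc _) (univ_gen s)).trans (ι_desc _ s)

theorem homEquiv_gen {T : ModuleCat.{u} ℤ} (ψ : chainGroup N k ⟶ T) (s : NerveSimplex C k) :
    ((homEquiv T ψ).app (op s.1)).hom (barGen s) = (ι s ≫ ψ : N.obj s.1 ⟶ T) :=
  congrArg (fun z : N.obj s.1 ⟶ chainGroup N k => z ≫ ψ) (univ_gen s)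

theorem homEquiv_comp {T T' : ModuleCat.{u} ℤ} (ψ : chainGroup N k ⟶ T) (g : T ⟶ T') :
    homEquiv T' (ψ ≫ g) = homEquiv T ψ ≫ N.homTo.map g := by
  simp [homEquiv]

variable (N k) in
/-- The boundary map on chains. -/
def d : chainGroup N (k + 1) ⟶ chainGroup N k := (homEquiv _).symm (barD k ≫ univ N k)

theorem homEquiv_d_comp {T : ModuleCat.{u} ℤ} (ψ : chainGroup N k ⟶ T) :
    homEquiv T (d N k ≫ ψ) = barD k ≫ homEquiv T ψ := by
  rw [homEquiv_comp, d, Equiv.apply_symm_apply, Category.assoc]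
  rfl

theorem homEquiv_zero (T : ModuleCat.{u} ℤ) : homEquiv (N := N) (k := k) T 0 = 0 := by
  refine (bar_isModBasis k).hom_ext fun s => (homEquiv_gen 0 s).trans ?_
  exact comp_zero

theorem d_comp_d : d N (k + 1) ≫ d N k = 0 := by
  apply (homEquiv _).injective
  rw [homEquiv_d_comp, d, Equiv.apply_symm_apply, ← Category.assoc, barD_comp, zero_comp,
    homEquiv_zero]

open Abelian

/-- The characters of the chain complex form the complex of bar cochains in `N.dual`, and characters
detect exactness. -/
theorem exact_iff (N : LeftMod C) (j : ℕ) :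
    Subsingleton (Ext (constZ C) N.dual (j + 1)) ↔
      ∀ z : chainGroup N (j + 1), (d N j).hom z = 0 → ∃ w, (d N (j + 1)).hom w = z := by
  have h := ShortComplex.moduleCat_exact_iff (ShortComplex.mk _ _ (d_comp_d (N := N) (k := j)))
  rw [exact_iff_characters] at h
  refine Iff.trans ?_ h
  rw [subsingleton_ext_constZ_iff]
  symm
  refine (Equiv.forall_congr (homEquiv rationalCircle) fun {φ} => ?_)
  dsimp only
  refine imp_congr ?_ (Equiv.exists_congr (homEquiv rationalCircle) fun {ψ} => ?_)
  · rw [← (homEquiv rationalCircle).apply_eq_iff_eq, homEquiv_d_comp, homEquiv_zero]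
    rfl
  · rw [← (homEquiv rationalCircle).apply_eq_iff_eq, homEquiv_d_comp]
    rfl

end chainGroup

variable {D : Type u} [SmallCategory D] (J : D ⥤ C)

/-- The map on chains induced by a functor. -/
def chainGroupMap (N : LeftMod C) (k : ℕ) :
    chainGroup (C := D) (J ⋙ N) k ⟶ chainGroup N k :=
  chainGroup.desc fun s => chainGroup.ι (N := N) (nerveSimplexMap J s)

theorem ι_chainGroupMap (N : LeftMod C) {k : ℕ} (s : NerveSimplex D k) :
    chainGroup.ι (N := J ⋙ N) s ≫ chainGroupMap J N k =
      chainGroup.ι (N := N) (nerveSimplexMap J s) :=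
  chainGroup.ι_desc (N := J ⋙ N) _ s

theorem homEquiv_chainGroupMap_comp (N : LeftMod C) {k : ℕ} {T : ModuleCat.{u} ℤ}
    (ψ : chainGroup N k ⟶ T) :
    chainGroup.homEquiv T (chainGroupMap J N k ≫ ψ) =
      resCochain J (chainGroup.homEquiv T ψ) := by
  refine (bar_isModBasis k).hom_ext fun s => (chainGroup.homEquiv_gen _ s).trans ?_
  refine Eq.trans ?_ ((resCochain_gen J _ s).trans
    (chainGroup.homEquiv_gen ψ (nerveSimplexMap J s))).symm
  exact congrArg (· ≫ ψ) (ι_chainGroupMap J N s)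

theorem chainGroupMap_d (N : LeftMod C) (k : ℕ) :
    chainGroupMap J N (k + 1) ≫ chainGroup.d N k =
      chainGroup.d (C := D) (J ⋙ N) k ≫ chainGroupMap J N k := by
  apply (chainGroup.homEquiv _).injective
  rw [homEquiv_chainGroupMap_comp, chainGroup.homEquiv_d_comp,
    -- A Yoneda argument: identities are inserted so that both composites are expressed through the
    -- universal cochain.
    ← Category.comp_id (chainGroupMap J N k), homEquiv_chainGroupMap_comp,
    ← Category.comp_id (chainGroup.d N k), chainGroup.homEquiv_d_comp, resCochain_barD]
  rfl

theorem chainGroupMap_injective (N : LeftMod C) {k : ℕ}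
    (hJ : Function.Injective (nerveSimplexMap (k := k) J)) :
    Function.Injective (chainGroupMap J N k).hom := by
  obtain ⟨r, hr⟩ := directSumMod.exists_retraction
    (M := fun s : NerveSimplex C k => N.obj s.1) hJ
  have h : chainGroupMap J N k ≫ r = 𝟙 (chainGroup (C := D) (J ⋙ N) k) := by
    refine chainGroup.hom_ext fun s => ?_
    refine (congrArg (· ≫ r) (ι_chainGroupMap J N s)).trans ?_
    exact (hr s).trans (Category.comp_id _).symm
  intro a b hab
  have h' := congrArg r.hom hab
  have key : ∀ a, r.hom ((chainGroupMap J N k).hom a) = a := fun a =>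
    congrArg (fun g => g.hom a) h
  rwa [key, key] at h'

theorem exists_finset_mem_range_chainGroupMap (N : LeftMod C) {k : ℕ} (z : chainGroup N k) :
    ∃ F : Finset (NerveSimplex C k), ∀ {D : Type u} [SmallCategory D] (J : D ⥤ C),
      (∀ s ∈ F, s ∈ Set.range (nerveSimplexMap J)) → ∃ w, (chainGroupMap J N k).hom w = z := by
  obtain ⟨F, hF⟩ := directSumMod.exists_finset z
  refine ⟨F, fun J hJ => hF (LinearMap.range (chainGroupMap J N k).hom) fun s hs n => ?_⟩
  obtain ⟨t, rfl⟩ := hJ s hs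
  exact ⟨(chainGroup.ι (N := J ⋙ N) t).hom n, congrArg (fun g => g.hom n) (ι_chainGroupMap J N t)⟩

open Abelian

/-- If every finite set of simplices of the nerve of `C` lies in the nerve of one of the categories
`D i`, then the vanishing of the homology of the `D i` implies that of `C`. -/
theorem subsingleton_ext_constZ_dual_of_directed {I : Type w} {D : I → Type u}
    [∀ i, SmallCategory (D i)] (J : ∀ i, D i ⥤ C) (k : ℕ)
    (hinj : ∀ i k, Function.Injective (nerveSimplexMap (k := k) (J i)))
    (hcover : ∀ F : Finset (NerveSimplex C (k + 1)), ∃ i, ∀ s ∈ F,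
      s ∈ Set.range (nerveSimplexMap (J i)))
    (N : LeftMod C)
    (h : ∀ i, Subsingleton (Ext (constZ (D i))
      (LeftMod.dual (C := D i) (J i ⋙ N)) (k + 1))) :
    Subsingleton (Ext (constZ C) N.dual (k + 1)) := by
  rw [chainGroup.exact_iff]
  intro z hz
  obtain ⟨F, hF⟩ := exists_finset_mem_range_chainGroupMap N z
  obtain ⟨i, hi⟩ := hcover F
  obtain ⟨w, rfl⟩ := hF (J i) hi
  -- The lift `w` of the cycle is again a cycle because chains on `D i` inject into chains on `C`.
  have hw : (chainGroup.d (C := D i) (J i ⋙ N) k).hom w = 0 := by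
    apply chainGroupMap_injective (J i) N (hinj i k)
    rw [map_zero]
    exact (congrArg (fun g => g.hom w) (chainGroupMap_d (J i) N k)).symm.trans hz
  obtain ⟨y, rfl⟩ := (chainGroup.exact_iff _ _).1 (h i) w hw
  exact ⟨(chainGroupMap (J i) N _).hom y,
    congrArg (fun g => g.hom y) (chainGroupMap_d (J i) N (k + 1))⟩

end ChainGroups
end

/-! ### Transfer of Ext along equivalences and Kan extensions. -/

noncomputable section

section Transfer

variable {C D : Type u} [SmallCategory C] [SmallCategory D]

open Abelian

theorem NerveChain.map_injective (J : D ⥤ C) (hobj : Function.Injective J.obj) [J.Faithful] {k : ℕ}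
    {c : D} (σ τ : NerveChain D k c) (h : σ.map J = τ.map J) : σ = τ := by
  induction σ with
  | nil c => cases τ; rfl
  | cons f σ ih =>
    cases τ with
    | cons g τ =>
      simp only [NerveChain.map, NerveChain.cons.injEq] at h
      obtain ⟨h1, h2, h3⟩ := h
      obtain rfl := hobj h1
      rw [J.map_injective (eq_of_heq h2), ih τ (eq_of_heq h3)]

theorem nerveSimplexMap_injective (J : D ⥤ C) (hobj : Function.Injective J.obj) [J.Faithful]
    (k : ℕ) : Function.Injective (nerveSimplexMap (k := k) J) := by
  rintro ⟨c, σ⟩ ⟨c', τ⟩ h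
  simp only [nerveSimplexMap, Sigma.mk.injEq] at h
  obtain rfl := hobj h.1
  rw [NerveChain.map_injective J hobj σ τ (eq_of_heq h.2)]

theorem subsingleton_ext_constZ_res_iff_of_isEquivalence (R : D ⥤ C) [R.IsEquivalence]
    (Y : RightMod C) (j : ℕ) :
    Subsingleton (Ext (constZ D) ((resMod R).obj Y) (j + 1)) ↔
      Subsingleton (Ext (constZ C) Y (j + 1)) := by
  have : (resMod R).IsEquivalence := inferInstance
  have hp : ∀ k, Projective ((resMod R).obj (bar C k)) := fun k =>
    ((resMod R).asEquivalence.map_projective_iff _).2 (bar_isModBasis k).projective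
  rw [subsingleton_ext_constZ_res_iff R hp, subsingleton_ext_constZ_iff]
  constructor
  · intro h f hf
    obtain ⟨g, hg⟩ := h ((resMod R).map f) (by rw [← Functor.map_comp, hf, Functor.map_zero])
    obtain ⟨g, rfl⟩ := (resMod R).map_surjective g
    exact ⟨g, (resMod R).map_injective (by rw [Functor.map_comp, hg])⟩
  · intro h f hf
    obtain ⟨f, rfl⟩ := (resMod R).map_surjective f
    obtain ⟨g, rfl⟩ := h f ((resMod R).map_injective (by
      rw [Functor.map_comp, hf, Functor.map_zero]))
    exact ⟨(resMod R).map g, ((resMod R).map_comp _ _).symm⟩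

/-- Exchanging the arguments of a bilinear map. -/
def flipHomEquiv {R : Type w} [CommRing R] (A B J : ModuleCat.{u} R) :
    (A ⟶ (((linearYoneda R (ModuleCat.{u} R)).obj J).obj (op B))) ≃
      (B ⟶ (((linearYoneda R (ModuleCat.{u} R)).obj J).obj (op A))) where
  toFun φ := ModuleCat.ofHom
    { toFun := fun b => ModuleCat.ofHom
        { toFun := fun a => ModuleCat.Hom.hom (A := B) (B := J) (φ.hom a) b
          map_add' := fun a a' => by rw [map_add]; rfl
          map_smul' := fun r a => by rw [map_smul]; rfl }
      map_add' := fun b b' => by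
        apply ModuleCat.hom_ext
        apply LinearMap.ext
        exact fun a => map_add (ModuleCat.Hom.hom (A := B) (B := J) (φ.hom a)) b b'
      map_smul' := fun r b => by
        apply ModuleCat.hom_ext
        apply LinearMap.ext
        exact fun a => map_smul (ModuleCat.Hom.hom (A := B) (B := J) (φ.hom a)) r b }
  invFun φ := ModuleCat.ofHom
    { toFun := fun b => ModuleCat.ofHom
        { toFun := fun a => ModuleCat.Hom.hom (A := A) (B := J) (φ.hom a) b
          map_add' := fun a a' => by rw [map_add]; rfl
          map_smul' := fun r a => by rw [map_smul]; rfl }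
      map_add' := fun b b' => by
        apply ModuleCat.hom_ext
        apply LinearMap.ext
        exact fun a => map_add (ModuleCat.Hom.hom (A := A) (B := J) (φ.hom a)) b b'
      map_smul' := fun r b => by
        apply ModuleCat.hom_ext
        apply LinearMap.ext
        exact fun a => map_smul (ModuleCat.Hom.hom (A := A) (B := J) (φ.hom a)) r b }
  left_inv _ := rfl
  right_inv _ := rfl

/-- Duality between left and right modules is self-adjoint. -/
def dualFlip (M : RightMod C) (N : LeftMod C) : (M ⟶ N.dual) ≃ (N ⟶ M.dual) where
  toFun φ :=
    { app := fun c => flipHomEquiv (M.obj (op c)) (N.obj c) rationalCircle (φ.app (op c))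
      naturality := fun c c' f => by
        apply ModuleCat.hom_ext
        apply LinearMap.ext
        intro n
        apply ModuleCat.hom_ext
        apply LinearMap.ext
        intro m
        exact (congrArg (fun z : N.obj c ⟶ rationalCircle.{u} => z.hom n)
          (rightMod_naturality_apply φ f m)).symm }
  invFun ψ :=
    { app := fun c => (flipHomEquiv (M.obj c) (N.obj c.unop) rationalCircle).symm
        (ψ.app c.unop)
      naturality := fun c c' f => by
        apply ModuleCat.hom_ext
        apply LinearMap.ext
        intro m
        apply ModuleCat.hom_ext
        apply LinearMap.ext
        intro n
        exact (congrArg (fun z => ModuleCat.Hom.hom (A := M.obj c) (B := rationalCircle.{u})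
          (ModuleCat.Hom.hom z n) m) (ψ.naturality f.unop)).symm }
  left_inv _ := rfl
  right_inv _ := rfl

/-- The map of dual modules induced by a map of right modules. -/
def RightMod.dualMap {M M' : RightMod C} (g : M' ⟶ M) : M.dual ⟶ M'.dual where
  app c := ((linearYoneda ℤ (ModuleCat.{u} ℤ)).obj rationalCircle).map (g.app (op c)).op
  naturality c c' f := by
    apply ModuleCat.hom_ext
    apply LinearMap.ext
    intro ψ
    exact congrArg (fun z : M'.obj (op c') ⟶ M.obj (op c) => (z ≫ ψ : M'.obj (op c') ⟶ _))
      (g.naturality f.op).symm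

theorem dualFlip_comp {M M' : RightMod C} (N : LeftMod C) (g : M' ⟶ M) (φ : M ⟶ N.dual) :
    dualFlip M' N (g ≫ φ) = dualFlip M N φ ≫ RightMod.dualMap g := rfl

/-- Maps from a restricted right module to a dual module. -/
def resDualEquiv (J : D ⥤ C) (M : RightMod C) (N : LeftMod D) :
    ((resMod J).obj M ⟶ N.dual) ≃ (M ⟶ LeftMod.dual (C := C) (J.lan.obj N)) :=
  (dualFlip (C := D) ((resMod J).obj M) N).trans
    (((J.lanAdjunction (ModuleCat.{u} ℤ)).homEquiv N M.dual).symm.trans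
      (dualFlip M (J.lan.obj N)).symm)

theorem dualFlip_resDualEquiv (J : D ⥤ C) (M : RightMod C) (N : LeftMod D)
    (φ : (resMod J).obj M ⟶ N.dual) :
    dualFlip M (J.lan.obj N) (resDualEquiv J M N φ) =
      ((J.lanAdjunction (ModuleCat.{u} ℤ)).homEquiv N M.dual).symm
        (dualFlip (C := D) ((resMod J).obj M) N φ) :=
  (dualFlip M (J.lan.obj N)).apply_symm_apply _

theorem resDualEquiv_comp (J : D ⥤ C) {M M' : RightMod C} (N : LeftMod D) (g : M' ⟶ M)
    (φ : (resMod J).obj M ⟶ N.dual) :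
    resDualEquiv J M' N ((resMod J).map g ≫ φ) = g ≫ resDualEquiv J M N φ := by
  apply (dualFlip M' (J.lan.obj N)).injective
  have h1 := dualFlip_resDualEquiv J M' N ((resMod J).map g ≫ φ)
  have h2 := dualFlip_comp (M := M) (M' := M') (J.lan.obj N) g (resDualEquiv J M N φ)
  have h3 := dualFlip_resDualEquiv J M N φ
  have h4 := (J.lanAdjunction (ModuleCat.{u} ℤ)).homEquiv_naturality_right_symm
    (dualFlip (C := D) ((resMod J).obj M) N φ) (RightMod.dualMap g)
  refine h1.trans (Eq.trans ?_ h2.symm)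
  rw [h3]
  exact h4

/-- A Shapiro-type argument: by `resDualEquiv`, cochains on the restricted bar resolution with
values in `N.dual` are bar cochains over `C` with values in the dual of the left Kan extension. -/
theorem subsingleton_ext_constZ_dual_of_lan (J : D ⥤ C)
    (hJ : ∀ k, Projective ((resMod J).obj (bar C k))) (N : LeftMod D) (j : ℕ)
    (h : Subsingleton (Ext (constZ C) (LeftMod.dual (C := C) (J.lan.obj N)) (j + 1))) :
    Subsingleton (Ext (constZ D) N.dual (j + 1)) := by
  rw [subsingleton_ext_constZ_res_iff J hJ]
  rw [subsingleton_ext_constZ_iff] at h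
  intro f hf
  -- Preservation of zero comes from naturality along the zero endomorphism, so additivity of the
  -- equivalence is not needed.
  have h0 : ∀ M : RightMod C, resDualEquiv J M N 0 = 0 := fun M => by
    have := resDualEquiv_comp J N (0 : M ⟶ M) 0
    rwa [comp_zero, zero_comp] at this
  obtain ⟨g, hg⟩ := h (resDualEquiv J _ N f) (by rw [← resDualEquiv_comp, hf, h0])
  refine ⟨(resDualEquiv J _ N).symm g, (resDualEquiv J _ N).injective ?_⟩
  rw [resDualEquiv_comp, Equiv.apply_symm_apply, hg]

end Transfer
end

/-! ### Virtually cyclic subgroups. -/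

noncomputable section

section VirtuallyCyclic

theorem IsVirtuallyCyclic.of_injective {A B : Type*} [Group A] [Group B] (f : A →* B)
    (hf : Function.Injective f) (h : IsVirtuallyCyclic B) : IsVirtuallyCyclic A := by
  obtain ⟨C, hC, hi⟩ := h
  refine ⟨C.comap f, ?_, ⟨?_⟩⟩
  · let g : C.comap f →* C := (f.comp (C.comap f).subtype).codRestrict C fun x => x.2
    exact isCyclic_of_injective g fun x y hxy =>
      Subtype.ext (hf (congrArg (Subtype.val : C → B) hxy))
  · rw [Subgroup.index_comap]
    exact (Subgroup.isFiniteRelIndex_of_finiteIndex (H := C) (K := f.range)).relIndex_ne_zero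

variable {G : Type u} [Group G]

theorem vcFamily.of_conj {H K : Subgroup G} (hK : K ∈ vcFamily G) (g : G)
    (h : ∀ x ∈ H, g⁻¹ * x * g ∈ K) : H ∈ vcFamily G := by
  let f : H →* K :=
    ((MulAut.conj g⁻¹).toMonoidHom.comp H.subtype).codRestrict K fun x => by
      simpa using h x x.2
  exact IsVirtuallyCyclic.of_injective f (fun x y hxy => Subtype.ext
    ((MulAut.conj g⁻¹).injective (congrArg (Subtype.val : K → G) hxy))) hK

theorem vcFamily.subgroupOf {H : Subgroup G} (hH : H ∈ vcFamily G) (A : Subgroup G) :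
    H.subgroupOf A ∈ vcFamily A :=
  IsVirtuallyCyclic.of_injective ((A.subtype.comp (H.subgroupOf A).subtype).codRestrict H
    fun x => x.2) (fun _ _ hxy => Subtype.ext (Subtype.ext
      (congrArg (Subtype.val : H → G) hxy))) hH

theorem vcFamily.map_subtype {A : Subgroup G} {H : Subgroup A} (hH : H ∈ vcFamily A) :
    H.map A.subtype ∈ vcFamily G :=
  IsVirtuallyCyclic.of_injective (H.equivMapOfInjective A.subtype A.subtype_injective).symm
    (MulEquiv.injective _) hH

/-- A virtually cyclic group is generated by a generator of its cyclic subgroup and finitely many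
coset representatives, and directedness puts these into a single `Gl i`. -/
theorem vcFamily.exists_le_of_directed {ι : Type v} {Gl : ι → Subgroup G}
    (hdir : Directed (· ≤ ·) Gl) (hunion : ∀ g : G, ∃ i, g ∈ Gl i) {H : Subgroup G}
    (hH : H ∈ vcFamily G) : ∃ i, H ≤ Gl i := by
  obtain ⟨C, hC, hi⟩ := hH
  obtain ⟨c, hc⟩ := hC.exists_generator
  have : Nonempty ι := ⟨(hunion 1).choose⟩
  obtain ⟨i, hi⟩ := hunion ((c : H) : G)
  choose j hj using fun q : H ⧸ C => hunion ((q.out : H) : G)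
  obtain ⟨l, hl⟩ := hdir.finite_le j
  obtain ⟨m, him, hlm⟩ := hdir i l
  refine ⟨m, fun x hx => ?_⟩
  let y : H := ⟨x, hx⟩
  have h1 : (y : H ⧸ C).out⁻¹ * y ∈ C := QuotientGroup.eq.1 (QuotientGroup.out_eq' _)
  obtain ⟨n, hn⟩ := hc ⟨_, h1⟩
  have h2 : y = (y : H ⧸ C).out * (c : H) ^ n := by
    have := congrArg (Subtype.val : C → H) hn
    rw [eq_inv_mul_iff_mul_eq.1 (by simpa using this)]
  have h3 : x = (((y : H ⧸ C).out : H) : G) * ((c : H) : G) ^ n := by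
    simpa using congrArg (Subtype.val : H → G) h2
  rw [h3]
  exact mul_mem (hlm (hl _ (hj _))) (zpow_mem (him hi) n)

end VirtuallyCyclic

/-! ### Maps `G/H ⟶ G/K` as `H`-fixed points of `G/K`, and the subcategory attached to a subgroup.
-/

namespace OrbitCategory

variable {G : Type u} [Group G] {F : Set (Subgroup G)} {X Y Z : OrbitCategory F}

/-- The map of coset spaces underlying a morphism of the orbit category. -/
def toFun (f : X ⟶ Y) : G ⧸ X.subgroup → G ⧸ Y.subgroup :=
  MulActionHom.toFun (f : (G ⧸ X.subgroup) →[G] (G ⧸ Y.subgroup))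

/-- The image of the base point under a morphism of the orbit category. -/
def pt (f : X ⟶ Y) : G ⧸ Y.subgroup := toFun f ((1 : G) : G ⧸ X.subgroup)

theorem toFun_mk (f : X ⟶ Y) (g : G) : toFun f (g : G ⧸ X.subgroup) = g • pt f := by
  refine Eq.trans ?_
    (MulActionHom.map_smul' (f : (G ⧸ X.subgroup) →[G] (G ⧸ Y.subgroup)) g ((1 : G) : _))
  rw [MulAction.Quotient.smul_coe, smul_eq_mul, mul_one]
  rfl

theorem hom_ext {f g : X ⟶ Y} (h : pt f = pt g) : f = g := by
  apply MulActionHom.ext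
  intro x
  induction x using QuotientGroup.induction_on with
  | H x => exact (toFun_mk f x).trans ((congrArg (x • ·) h).trans (toFun_mk g x).symm)

theorem pt_comp (f : X ⟶ Y) (g : Y ⟶ Z) {a : G} (h : pt f = (a : G ⧸ Y.subgroup)) :
    pt (f ≫ g) = a • pt g :=
  (congrArg (toFun g) h).trans (toFun_mk g a)

theorem smul_pt (f : X ⟶ Y) {x : G} (hx : x ∈ X.subgroup) : x • pt f = pt f := by
  rw [← toFun_mk, pt, (QuotientGroup.eq (a := (1 : G)) (b := x)).2 (by simpa using hx)]

/-- A fixed point of `H` in `G/K` gives a map `G/H ⟶ G/K`. -/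
def ofFixed (y : G ⧸ Y.subgroup) (hy : ∀ x ∈ X.subgroup, x • y = y) : X ⟶ Y :=
  show (G ⧸ X.subgroup) →[G] (G ⧸ Y.subgroup) from
  { toFun := fun z => Quotient.liftOn' z (fun g => g • y) fun a b h => by
      have := hy _ (QuotientGroup.leftRel_apply.1 h)
      rw [mul_smul, inv_smul_eq_iff] at this
      exact this.symm
    map_smul' := fun g z => by
      induction z using QuotientGroup.induction_on with
      | H z => exact mul_smul g z y }

theorem pt_ofFixed (y : G ⧸ Y.subgroup) (hy : ∀ x ∈ X.subgroup, x • y = y) :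
    pt (ofFixed y hy) = y := one_smul G y

end OrbitCategory

/-- The subcategory of the orbit category of `G` of the objects `G/H` with `H ≤ A` and of the
morphisms that are given by elements of `A`. -/
structure SubOrbit {G : Type u} [Group G] (F : Set (Subgroup G)) (A : Subgroup G) : Type u where
  /-- the underlying object of the orbit category -/
  obj : OrbitCategory F
  le : obj.subgroup ≤ A

namespace SubOrbit

open OrbitCategory

section

variable {G : Type u} [Group G] {F : Set (Subgroup G)} {A : Subgroup G}

instance category : SmallCategory (SubOrbit F A) where
  Hom X Y := {f : X.obj ⟶ Y.obj // ∃ a ∈ A, pt f = (a : G ⧸ Y.obj.subgroup)}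
  id X := ⟨𝟙 X.obj, 1, one_mem A, rfl⟩
  comp f g := ⟨f.1 ≫ g.1, by
    obtain ⟨a, ha, h⟩ := f.2
    obtain ⟨b, hb, h'⟩ := g.2
    exact ⟨a * b, mul_mem ha hb, by rw [pt_comp _ _ h, h']; rfl⟩⟩

variable (F A) in
/-- The inclusion into the orbit category. -/
def incl : SubOrbit F A ⥤ OrbitCategory F where
  obj X := X.obj
  map f := f.1

instance : (incl F A).Faithful where
  map_injective h := Subtype.ext h

theorem incl_obj_injective : Function.Injective (incl F A).obj := by
  rintro ⟨X, _⟩ ⟨Y, _⟩ h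
  obtain rfl : X = Y := h
  rfl

end

end SubOrbit

/-- A chain in the orbit category that comes from the subgroup `A`. -/
def NerveChain.IsSubordinate {G : Type u} [Group G] {F : Set (Subgroup G)} (A : Subgroup G) :
    ∀ {k : ℕ} {X : OrbitCategory F}, NerveChain (OrbitCategory F) k X → Prop
  | _, _, .nil X => X.subgroup ≤ A
  | _, X, .cons (c' := Y) f σ => X.subgroup ≤ A ∧
      (∃ a ∈ A, OrbitCategory.pt f = (a : G ⧸ Y.subgroup)) ∧ σ.IsSubordinate A

namespace NerveChain

open SubOrbit

variable {G : Type u} [Group G] {F : Set (Subgroup G)} {k : ℕ}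

theorem IsSubordinate.mono {A B : Subgroup G} (hAB : A ≤ B) {X : OrbitCategory F}
    {σ : NerveChain (OrbitCategory F) k X} (h : σ.IsSubordinate A) : σ.IsSubordinate B := by
  induction σ with
  | nil X => exact le_trans h hAB
  | cons f σ ih =>
    obtain ⟨h1, ⟨a, ha, h2⟩, h3⟩ := h
    exact ⟨h1.trans hAB, ⟨a, hAB ha, h2⟩, ih h3⟩

theorem isSubordinate_map {A : Subgroup G} {X : SubOrbit F A} (σ : NerveChain (SubOrbit F A) k X) :
    (σ.map (incl F A)).IsSubordinate A := by
  induction σ with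
  | nil X => exact X.le
  | @cons _ X Y f σ ih => exact ⟨X.le, f.2, ih⟩

theorem IsSubordinate.mem_range {A : Subgroup G} {X : OrbitCategory F}
    {σ : NerveChain (OrbitCategory F) k X} (h : σ.IsSubordinate A) :
    (⟨X, σ⟩ : NerveSimplex (OrbitCategory F) k) ∈ Set.range (nerveSimplexMap (incl F A)) := by
  induction σ with
  | nil X => exact ⟨⟨⟨X, h⟩, .nil _⟩, rfl⟩
  | cons f σ ih =>
    obtain ⟨h1, h2, h3⟩ := h
    obtain ⟨⟨Y, τ⟩, hτ⟩ := ih h3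
    cases hτ
    exact ⟨⟨⟨_, h1⟩, .cons (c' := Y) ⟨f, h2⟩ τ⟩, rfl⟩

/-- The intrinsic predicate avoids equalities between objects of the subcategory, and it is visibly
monotone in `A`. -/
theorem mem_range_incl_iff {A : Subgroup G} (s : NerveSimplex (OrbitCategory F) k) :
    s ∈ Set.range (nerveSimplexMap (incl F A)) ↔ s.2.IsSubordinate A := by
  constructor
  · rintro ⟨t, rfl⟩
    exact isSubordinate_map t.2
  · exact fun h => h.mem_range

/-- A chain involves finitely many virtually cyclic subgroups and finitely many coset
representatives. -/
theorem exists_isSubordinate {ι : Type v} {Gl : ι → Subgroup G}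
    (hdir : Directed (· ≤ ·) Gl) (hunion : ∀ g : G, ∃ i, g ∈ Gl i)
    {X : OrbitCategory (vcFamily G)} (σ : NerveChain (OrbitCategory (vcFamily G)) k X) :
    ∃ i, σ.IsSubordinate (Gl i) := by
  induction σ with
  | nil X => exact vcFamily.exists_le_of_directed hdir hunion X.mem
  | @cons _ X Y f σ ih =>
    obtain ⟨i, hi⟩ := ih
    obtain ⟨j, hj⟩ := vcFamily.exists_le_of_directed hdir hunion X.mem
    obtain ⟨a, ha⟩ := QuotientGroup.mk_surjective (OrbitCategory.pt f)
    obtain ⟨l, hl⟩ := hunion a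
    obtain ⟨m, him, hjm⟩ := hdir i j
    obtain ⟨n, hmn, hln⟩ := hdir m l
    exact ⟨n, hj.trans (hjm.trans hmn), ⟨a, hln hl, ha.symm⟩, hi.mono (him.trans hmn)⟩

theorem exists_forall_mem_range_incl {ι : Type v} {Gl : ι → Subgroup G}
    (hdir : Directed (· ≤ ·) Gl) (hunion : ∀ g : G, ∃ i, g ∈ Gl i)
    (S : Finset (NerveSimplex (OrbitCategory (vcFamily G)) k)) :
    ∃ i, ∀ s ∈ S, s ∈ Set.range (nerveSimplexMap (incl (vcFamily G) (Gl i))) := by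
  have : Nonempty ι := ⟨(hunion 1).choose⟩
  choose j hj using fun s : NerveSimplex (OrbitCategory (vcFamily G)) k =>
    exists_isSubordinate hdir hunion s.2
  classical
  obtain ⟨i, hi⟩ := hdir.finset_le (S.image j)
  exact ⟨i, fun s hs => (mem_range_incl_iff s).2
    ((hj s).mono (hi _ (Finset.mem_image_of_mem j hs)))⟩

end NerveChain
end

/-! ### Comparison with the orbit category of the subgroup, and projectivity of restriction. -/

noncomputable section

namespace SubOrbit

open OrbitCategory

variable {G : Type u} [Group G] {A : Subgroup G}

/-- The object `A/H` of the orbit category of `A` given by the object `G/H` with `H ≤ A`. -/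
def toOrbitObj (X : SubOrbit (vcFamily G) A) : OrbitCategory (vcFamily A) :=
  ⟨X.obj.subgroup.subgroupOf A, vcFamily.subgroupOf X.obj.mem A⟩

theorem conj_mem_of_fixed {H : Subgroup G} {x a : G}
    (h : x • (a : G ⧸ H) = (a : G ⧸ H)) : a⁻¹ * x * a ∈ H := by
  have := QuotientGroup.eq.1 (show ((a : G) : G ⧸ H) = ((x * a : G) : G ⧸ H) from h.symm)
  rwa [← mul_assoc] at this

theorem fixed_of_conj_mem {H : Subgroup G} {x a : G} (h : a⁻¹ * x * a ∈ H) :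
    x • (a : G ⧸ H) = (a : G ⧸ H) := by
  refine (show ((a : G) : G ⧸ H) = ((x * a : G) : G ⧸ H) from QuotientGroup.eq.2 ?_).symm
  rwa [← mul_assoc]

theorem exists_rep {X Y : SubOrbit (vcFamily G) A} (f : X ⟶ Y) :
    ∃ a : A, pt f.1 = ((a : G) : G ⧸ Y.obj.subgroup) :=
  let ⟨a, ha, h⟩ := f.2
  ⟨⟨a, ha⟩, h⟩

/-- The map `A/H ⟶ A/K` given by a map `G/H ⟶ G/K` that is represented by an element of `A`. -/
def toOrbitMap {X Y : SubOrbit (vcFamily G) A} (f : X ⟶ Y) : toOrbitObj X ⟶ toOrbitObj Y :=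
  ofFixed ((exists_rep f).choose : A ⧸ (toOrbitObj Y).subgroup) fun x hx => fixed_of_conj_mem (by
    have h := smul_pt f.1 (show (x : G) ∈ X.obj.subgroup from hx)
    rw [(exists_rep f).choose_spec] at h
    exact conj_mem_of_fixed (H := Y.obj.subgroup) (x := x) (a := (exists_rep f).choose) h)

theorem mk_eq_mk_iff {Y : SubOrbit (vcFamily G) A} (a b : A) :
    (a : A ⧸ (toOrbitObj Y).subgroup) = (b : A ⧸ (toOrbitObj Y).subgroup) ↔
      ((a : G) : G ⧸ Y.obj.subgroup) = ((b : G) : G ⧸ Y.obj.subgroup) :=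
  QuotientGroup.eq.trans (Iff.trans Iff.rfl
    (QuotientGroup.eq (s := Y.obj.subgroup) (a := (a : G)) (b := (b : G))).symm)

/-- Injectivity of `A/(K ∩ A) → G/K` makes the chosen representative in `toOrbitMap` irrelevant: any
representative in `A` may be used. -/
theorem pt_toOrbitMap_iff {X Y : SubOrbit (vcFamily G) A} (f : X ⟶ Y) (a : A) :
    pt (toOrbitMap f) = (a : A ⧸ (toOrbitObj Y).subgroup) ↔
      pt f.1 = ((a : G) : G ⧸ Y.obj.subgroup) := by
  rw [toOrbitMap, pt_ofFixed, mk_eq_mk_iff, ← (exists_rep f).choose_spec]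

variable (A) in
/-- The comparison functor to the orbit category of `A`. -/
def toOrbit : SubOrbit (vcFamily G) A ⥤ OrbitCategory (vcFamily A) where
  obj := toOrbitObj
  map := toOrbitMap
  map_id X := OrbitCategory.hom_ext ((pt_toOrbitMap_iff (𝟙 X) 1).2 rfl)
  map_comp {X Y Z} f g := OrbitCategory.hom_ext (by
    obtain ⟨a, ha⟩ := exists_rep f
    obtain ⟨b, hb⟩ := exists_rep g
    rw [pt_comp _ _ ((pt_toOrbitMap_iff f a).2 ha), (pt_toOrbitMap_iff g b).2 hb]
    refine (pt_toOrbitMap_iff (f ≫ g) (a * b)).2 ?_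
    refine (pt_comp f.1 g.1 ha).trans ?_
    rw [hb]
    rfl)

instance : (toOrbit A).Faithful where
  map_injective {X Y f g} h := Subtype.ext (OrbitCategory.hom_ext (by
    obtain ⟨a, ha⟩ := exists_rep f
    rw [ha]
    have h' : toOrbitMap f = toOrbitMap g := h
    exact ((pt_toOrbitMap_iff g a).1 (h' ▸ (pt_toOrbitMap_iff f a).2 ha)).symm))

instance : (toOrbit A).Full where
  map_surjective {X Y} φ := by
    obtain ⟨a, ha⟩ := QuotientGroup.mk_surjective (pt φ)
    have hfix : ∀ x ∈ X.obj.subgroup, x • ((a : G) : G ⧸ Y.obj.subgroup) =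
        ((a : G) : G ⧸ Y.obj.subgroup) := fun x hx => by
      have h := smul_pt φ (x := ⟨x, X.le hx⟩) hx
      rw [← ha] at h
      exact fixed_of_conj_mem (conj_mem_of_fixed (H := (toOrbitObj Y).subgroup) (a := a) h)
    exact ⟨⟨ofFixed _ hfix, a, a.2, pt_ofFixed _ hfix⟩,
      OrbitCategory.hom_ext (((pt_toOrbitMap_iff _ a).2 (pt_ofFixed _ hfix)).trans ha)⟩

instance : (toOrbit A).EssSurj where
  mem_essImage Y := by
    obtain ⟨H, hH⟩ := Y
    refine ⟨⟨⟨H.map A.subtype, vcFamily.map_subtype hH⟩, Subgroup.map_subtype_le H⟩, ⟨eqToIso ?_⟩⟩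
    change OrbitCategory.mk _ _ = _
    congr 1
    exact Subgroup.comap_map_eq_self_of_injective A.subtype_injective H

instance : (toOrbit A).IsEquivalence where

end SubOrbit

theorem freeAb.isIso_desc_of_bijective {S T : Type u} (e : S → T) (he : Function.Bijective e) :
    IsIso (freeAb.desc (M := freeAb T) fun s => freeAb.ι (e s)) := by
  let e' := Equiv.ofBijective e he
  refine ⟨freeAb.desc fun t => freeAb.ι (e'.symm t), freeAb.hom_ext fun s => ?_,
    freeAb.hom_ext fun t => ?_⟩
  · refine (congrArg (freeAb.desc _).hom (freeAb.desc_ι _ s)).trans ((freeAb.desc_ι _ _).trans ?_)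
    rw [show e s = e' s from rfl, Equiv.symm_apply_apply]
    rfl
  · refine (congrArg (freeAb.desc _).hom (freeAb.desc_ι _ t)).trans ((freeAb.desc_ι _ _).trans ?_)
    rw [show e (e'.symm t) = e' (e'.symm t) from rfl, Equiv.apply_symm_apply]
    rfl

/-- If all the functors `Hom(J -, c)` are sums of representable functors, then the restriction of
the bar resolution along `J` consists of projectives. -/
theorem projective_res_bar {C D : Type u} [SmallCategory C] [SmallCategory D] (J : D ⥤ C)
    {Q : C → Type u} (d : ∀ c, Q c → D) (t : ∀ c (q : Q c), J.obj (d c q) ⟶ c)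
    (h : ∀ c x, Function.Bijective
      (fun p : Σ q : Q c, (x ⟶ d c q) => (J.map p.2 ≫ t c p.1 : J.obj x ⟶ c))) (k : ℕ) :
    Projective ((resMod J).obj (bar C k)) := by
  have hb : IsModBasis ((resMod J).obj (bar C k))
      (fun p : Σ s : NerveSimplex C k, Q s.1 => d p.1.1 p.2)
      (fun p => (barElt ⟨p.1, t p.1.1 p.2⟩ : (bar C k).obj (op (J.obj (d p.1.1 p.2))))) := by
    intro x
    -- The restricted module has one basis element for each simplex and each summand `q` at its
    -- initial vertex; `e` matches the resulting basis at `x` with that of the bar resolution.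
    let e : (Σ p : Σ s : NerveSimplex C k, Q s.1, (x ⟶ d p.1.1 p.2)) → BarIndex k (J.obj x) :=
      fun p => ⟨p.1.1, J.map p.2 ≫ t p.1.1.1 p.1.2⟩
    have he : Function.Bijective e := by
      constructor
      · rintro ⟨⟨s, q⟩, f⟩ ⟨⟨s', q'⟩, f'⟩ hp
        obtain rfl : s = s' := congrArg Sigma.fst hp
        have h1 := (h s.1 x).1 (a₁ := ⟨q, f⟩) (a₂ := ⟨q', f'⟩) (eq_of_heq (Sigma.mk.inj hp).2)
        cases h1
        rfl
      · rintro ⟨s, g⟩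
        obtain ⟨⟨q, f⟩, hf⟩ := (h s.1 x).2 g
        exact ⟨⟨⟨s, q⟩, f⟩, congrArg (Sigma.mk s) hf⟩
    have h2 := freeAb.isIso_desc_of_bijective e he
    have h3 : basisMap ((resMod J).obj (bar C k))
      (fun p : Σ s : NerveSimplex C k, Q s.1 => d p.1.1 p.2)
      (fun p => (barElt ⟨p.1, t p.1.1 p.2⟩ : (bar C k).obj (op (J.obj (d p.1.1 p.2))))) x =
      freeAb.desc (M := freeAb (BarIndex k (J.obj x))) fun s => freeAb.ι (e s) := by
      apply freeAb.hom_ext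
      rintro ⟨⟨s, q⟩, f⟩
      exact (basisMap_ι _ _ _ _ _).trans
        ((bar_map_elt (J.map f) ⟨s, t s.1 q⟩).trans (freeAb.desc_ι
          (M := freeAb (BarIndex k (J.obj x))) (fun p => freeAb.ι (e p)) ⟨⟨s, q⟩, f⟩).symm)
    rw [h3]
    exact h2
  exact hb.projective

namespace SubOrbit

open OrbitCategory

variable {G : Type u} [Group G] (A : Subgroup G)

/-- The object of `SubOrbit` given by the stabilizer in `A` of a point of a coset space. -/
def stab (c : OrbitCategory (vcFamily G)) (y : G ⧸ c.subgroup) : SubOrbit (vcFamily G) A where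
  obj :=
    { subgroup := MulAction.stabilizer G y ⊓ A
      mem := by
        obtain ⟨g, rfl⟩ := QuotientGroup.mk_surjective y
        exact vcFamily.of_conj c.mem g fun x hx => conj_mem_of_fixed hx.1 }
  le := inf_le_right

/-- For `H ≤ A`, a map `G/H ⟶ G/K` is an `H`-fixed point of `G/K`. It lies in exactly one `A`-orbit,
say that of `y`, and factors uniquely in `SubOrbit` through the stabilizer of `y` in `A`. So the
restricted representables are sums of representables. -/
theorem projective_res_incl_bar (k : ℕ) :
    Projective ((resMod (incl (vcFamily G) A)).obj (bar (OrbitCategory (vcFamily G)) k)) := by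
  refine projective_res_bar (incl (vcFamily G) A)
    (Q := fun c => MulAction.orbitRel.Quotient A (G ⧸ c.subgroup))
    (fun c q => stab A c q.out) (fun c q => ofFixed q.out fun x hx => hx.1) (fun c x => ?_) k
  have hpt : ∀ (q : MulAction.orbitRel.Quotient A (G ⧸ c.subgroup)) (f : x ⟶ stab A c q.out)
      {a : G} (ha : pt f.1 = (a : G ⧸ (stab A c q.out).obj.subgroup)),
      pt ((incl (vcFamily G) A).map f ≫ (ofFixed q.out fun x hx => hx.1 :
        (stab A c q.out).obj ⟶ c)) = a • q.out := fun q f a ha =>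
    (pt_comp f.1 _ ha).trans (congrArg (a • ·) (pt_ofFixed _ _))
  constructor
  · rintro ⟨q, f⟩ ⟨q', f'⟩ h
    obtain ⟨a, ha⟩ := exists_rep f
    obtain ⟨a', ha'⟩ := exists_rep f'
    have h1 : (a : G) • q.out = (a' : G) • q'.out :=
      (hpt q f ha).symm.trans ((congrArg pt h).trans (hpt q' f' ha'))
    have h2 : q = q' := by
      rw [← q.out_eq', ← q'.out_eq']
      refine Quotient.sound' ⟨a⁻¹ * a', ?_⟩
      change (((a⁻¹ * a' : A) : G)) • q'.out = q.out
      rw [Subgroup.coe_mul, mul_smul, ← h1]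
      exact inv_smul_smul _ _
    subst h2
    congr 1
    apply Subtype.ext
    apply OrbitCategory.hom_ext
    rw [ha, ha']
    refine QuotientGroup.eq.2 ⟨?_, (a⁻¹ * a').2⟩
    change ((a : G)⁻¹ * a') • q.out = q.out
    rw [mul_smul, ← h1, inv_smul_smul]
  · intro g
    let q : MulAction.orbitRel.Quotient A (G ⧸ c.subgroup) := Quotient.mk'' (pt g)
    obtain ⟨a, ha⟩ : ∃ a : A, (a : G) • q.out = pt g := by
      obtain ⟨a, ha⟩ := Quotient.exact' q.out_eq'
      refine ⟨a⁻¹, ?_⟩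
      rw [← ha]
      exact inv_smul_smul _ _
    have hfix : ∀ y ∈ x.obj.subgroup, y • ((a : G) : G ⧸ (stab A c q.out).obj.subgroup) =
        ((a : G) : G ⧸ (stab A c q.out).obj.subgroup) := fun y hy => by
      refine fixed_of_conj_mem ⟨?_, (a⁻¹ * ⟨y, x.le hy⟩ * a).2⟩
      change ((a : G)⁻¹ * y * a) • q.out = q.out
      rw [mul_smul, mul_smul, ha, inv_smul_eq_iff, ha]
      exact smul_pt g hy
    exact ⟨⟨q, ⟨ofFixed _ hfix, a, a.2, pt_ofFixed _ hfix⟩⟩,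
      OrbitCategory.hom_ext ((hpt q _ (pt_ofFixed _ hfix)).trans ha)⟩

end SubOrbit
end

/-! ### Comparison of dimensions. -/

noncomputable section

section Dimensions

open Abelian SubOrbit

variable {G : Type u} [Group G]

theorem subsingleton_ext_subOrbit_iff (A : Subgroup G)
    (Y : RightMod (SubOrbit (vcFamily G) A)) (j : ℕ) :
    Subsingleton (Ext (constZ (OrbitCategory (vcFamily A))) ((resMod (toOrbit A).inv).obj Y)
        (j + 1)) ↔
      Subsingleton (Ext (constZ (SubOrbit (vcFamily G) A)) Y (j + 1)) :=
  subsingleton_ext_constZ_res_iff_of_isEquivalence (toOrbit A).inv Y j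

theorem vcHd_le_iff (n : ℕ) : vcHd G ≤ n ↔
    ∀ (N : LeftMod (OrbitCategory (vcFamily G))) (j : ℕ), n ≤ j →
      Subsingleton (Ext (constZ (OrbitCategory (vcFamily G))) N.dual (j + 1)) :=
  flatDimension_le_iff _ n

theorem vcHd_subgroup_le (A : Subgroup G) : vcHd A ≤ vcHd G := by
  induction h : vcHd G with
  | top => exact le_top
  | coe n =>
    refine (vcHd_le_iff n).2 fun N j hj => ?_
    refine (subsingleton_ext_constZ_res_iff_of_isEquivalence (toOrbit A) N.dual j).1 ?_
    exact subsingleton_ext_constZ_dual_of_lan (incl (vcFamily G) A) (projective_res_incl_bar A)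
      (toOrbit A ⋙ N) j ((vcHd_le_iff n).1 h.le _ j hj)

theorem vcHd_le_of_directed {ι : Type v} {Gl : ι → Subgroup G}
    (hdir : Directed (· ≤ ·) Gl) (hunion : ∀ g : G, ∃ i, g ∈ Gl i) {n : ℕ}
    (h : ∀ i, vcHd (Gl i) ≤ n) : vcHd G ≤ n := by
  rw [vcHd_le_iff]
  intro N j hj
  refine subsingleton_ext_constZ_dual_of_directed (fun i => incl (vcFamily G) (Gl i)) j
    (fun i k => nerveSimplexMap_injective _ incl_obj_injective k)
    (NerveChain.exists_forall_mem_range_incl hdir hunion) N fun i => ?_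
  rw [← subsingleton_ext_subOrbit_iff]
  exact (vcHd_le_iff n).1 (h i) ((toOrbit (Gl i)).inv ⋙ incl (vcFamily G) (Gl i) ⋙ N) j hj

theorem vcCd_le_iff (n : ℕ) : vcCd G ≤ n ↔
    ∀ (Y : RightMod (OrbitCategory (vcFamily G))) (j : ℕ), n ≤ j →
      Subsingleton (Ext (constZ (OrbitCategory (vcFamily G))) Y (j + 1)) := by
  refine (projectiveDimension_le_iff _ n).trans ?_
  constructor
  · intro h Y j hj
    exact HasProjectiveDimensionLT.subsingleton (hX := h) (constZ _) (n + 1) (j + 1) (by omega) Y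
  · intro h
    refine (hasProjectiveDimensionLT_iff _ _).2 fun i hi Y e => ?_
    obtain ⟨j, rfl⟩ : ∃ j, i = j + 1 := ⟨i - 1, by omega⟩
    exact (h Y j (by omega)).elim e 0

theorem vcCd_le_of_sequence {H : ℕ → Subgroup G} (hH : Monotone H)
    (hunion : ∀ g : G, ∃ n, g ∈ H n) {m : ℕ} (h : ∀ n, vcCd (H n) ≤ m) :
    vcCd G ≤ (m + 1 : ℕ) := by
  rw [vcCd_le_iff]
  intro Y j hj
  -- Since `j ≥ m + 1`, both degrees `k + 1` and `k + 2` needed over the `H n` exceed `m`.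
  obtain ⟨k, rfl⟩ : ∃ k, j = k + 1 := ⟨j - 1, by omega⟩
  refine subsingleton_ext_constZ_of_sequence (fun n => incl (vcFamily G) (H n))
    (fun n k => nerveSimplexMap_injective _ incl_obj_injective k) ?_ ?_ Y k ?_ ?_
  · intro n k s hs
    rw [NerveChain.mem_range_incl_iff] at hs ⊢
    exact hs.mono (hH n.le_succ)
  · intro k s
    obtain ⟨n, hn⟩ := NerveChain.exists_isSubordinate hH.directed_le hunion s.2
    exact ⟨n, (NerveChain.mem_range_incl_iff s).2 hn⟩
  · intro n
    rw [← subsingleton_ext_subOrbit_iff]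
    exact (vcCd_le_iff m).1 (h n) _ _ (by omega)
  · intro n
    rw [← subsingleton_ext_subOrbit_iff]
    exact (vcCd_le_iff m).1 (h n) _ _ (by omega)

/-- Only the zero module has dimension `⊥`, and the trivial module has value `ℤ` at the orbit of the
trivial subgroup. -/
theorem vcCd_ne_bot : vcCd G ≠ ⊥ := by
  rw [vcCd, bredonCd, ne_eq, projectiveDimension_eq_bot_iff]
  intro h
  let X : OrbitCategory (vcFamily G) :=
    ⟨⊥, ⊥, inferInstance, Subgroup.finiteIndex_of_finite⟩
  have h1 := (Functor.isZero_iff _).1 h (op X)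
  have h2 := ModuleCat.subsingleton_of_isZero h1
  have h3 : (ULift.up 0 : ULift.{u} ℤ) = ULift.up 1 := h2.elim _ _
  simpa using congrArg ULift.down h3

theorem exists_monotone_sequence {ι : Type v} [Countable ι] {Gl : ι → Subgroup G}
    (hdir : Directed (· ≤ ·) Gl) (hunion : ∀ g : G, ∃ i, g ∈ Gl i) :
    ∃ s : ℕ → ι, Monotone (fun n => Gl (s n)) ∧ ∀ g : G, ∃ n, g ∈ Gl (s n) := by
  have : Nonempty ι := ⟨(hunion 1).choose⟩
  have := Encodable.ofCountable ι
  have : Inhabited ι := Classical.inhabited_of_nonempty inferInstance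
  refine ⟨hdir.sequence Gl, hdir.sequence_mono, fun g => ?_⟩
  obtain ⟨i, hi⟩ := hunion g
  exact ⟨_, hdir.le_sequence i hi⟩

end Dimensions

end

theorem mainTheorem5 {G : Type u} [Group G] {ι : Type v} (Gl : ι → Subgroup G)
    (hdir : Directed (· ≤ ·) Gl) (hunion : ∀ g : G, ∃ i, g ∈ Gl i) :
    (vcHd G = ⨆ i, vcHd (Gl i)) ∧
      (Countable ι → vcCd G ≤ (⨆ i, vcCd (Gl i)) + 1) := by
  refine ⟨le_antisymm ?_ (iSup_le fun i => vcHd_subgroup_le (Gl i)), fun hι => ?_⟩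
  · induction h : ⨆ i, vcHd (Gl i) with
    | top => exact le_top
    | coe n => exact vcHd_le_of_directed hdir hunion fun i => h ▸ le_iSup (fun i => vcHd (Gl i)) i
  · obtain ⟨s, hs, hs'⟩ := exists_monotone_sequence hdir hunion
    have hle := le_iSup fun i => vcCd (Gl i)
    induction h : ⨆ i, vcCd (Gl i) with
    -- The index type is nonempty, so a supremum equal to `⊥` would force `⊥` for one of the
    -- subgroups.
    | bot => exact absurd (le_bot_iff.1 (h ▸ hle (s 0))) vcCd_ne_bot
    | coe d =>
      induction d with
      | top => exact le_top
      | coe m => exact vcCd_le_of_sequence hs hs' fun n => (hle (s n)).trans h.le
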